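/- \textbf{Setting.} Manifolds are smooth, real, finite-dimensional and without boundary. Let $\mathscr G\rightrightarrows M$ be a Lie groupoid with source $s$, target $t$ (surjective submersions), units $\mathrm{Id}_m$ and multiplication $g.h$ defined for $s(g)=t(h)$. For $g\in\mathscr G$ let $r_g\colon s^{-1}(t(g))\to\mathscr G$, $h\mapsto h.g$. Let $E=\mathrm{Id}^*\ker \mathrm Ts\to M$ be its Lie algebroid, with fibres $E_m=\ker \mathrm T_{\mathrm{Id}_m}s$, and let $\theta_{\mathrm R}(g)=\mathrm T_gr_{g^{-1}}\colon\ker \mathrm T_gs\to E_{t(g)}$ be the right-invariant Maurer--Cartan form. A bisection is a smooth map $\beta\colon M\to\mathscr G$ with $s\circ\beta=\mathrm{id}_M$ and $t\circ\beta$ a diffeomorphism of $M$; for a bisection $\beta$ put $\beta\,\underline\vartriangleright\, m=t(\beta(m))$ and $C_\beta(g)=\beta(t(g)).g.\beta(s(g))^{-1}$. A principaloid $\mathscr G$-bundle over a manifold $\Sigma$ is a manifold $\mathscr P$ with a smooth surjection $\pi\colon\mathscr P\to\Sigma$, a smooth map $\mu\colon\mathscr P\to M$ and a smooth right action $(p,g)\mapsto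 p\blacktriangleleft g=\varrho_g(p)$, defined for $\mu(p)=t(g)$, with $\mu(p\blacktriangleleft g)=s(g)$, $p\blacktriangleleft\mathrm{Id}_{\mu(p)}=p$, $(p\blacktriangleleft g)\blacktriangleleft h=p\blacktriangleleft(g.h)$ and $\pi(p\blacktriangleleft g)=\pi(p)$, such that $\Sigma$ is covered by open sets $O$ carrying equivariant local trivialisations, i.e. diffeomorphisms $\tau\colon\pi^{-1}(O)\to O\times\mathscr G$ over $O$ with $\mu(\tau^{-1}(\sigma,g))=s(g)$ and $\tau^{-1}(\sigma,g)\blacktriangleleft h=\tau^{-1}(\sigma,g.h)$ whenever $s(g)=t(h)$. For equivariant local trivialisations $\tau_i$ over $O_i$, $i\in I$, the transition bisections $\beta_{ij}(\sigma)$, $\sigma\in O_i\cap O_j$, are determined by $\tau_i\circ\tau_j^{-1}(\sigma,g)=(\sigma,\beta_{ij}(\sigma)(t(g)).g)$. A (compatible) connection 1-form on $\mathscr P$ is a smooth 1-form $\Theta$ on $\mathscr P$ with values in $\mathrm V\mathscr P=\ker \mathrm T\pi$ such that $\Theta|_{\mathrm V\mathscr P}=\mathrm{id}$, $\mathrm T\mu\circ\Theta=\mathrm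 T\mu$, and $\mathrm T_p\varrho_g(\ker\Theta_p)=\ker\Theta_{p\blacktriangleleft g}$ whenever $\mu(p)=t(g)$. Given equivariant local trivialisations $\{\tau_i\}_{i\in I}$ over an open cover $\{O_i\}_{i\in I}$ of $\Sigma$, local connection data are a family of smooth sections $A_i\in\Gamma(\mathrm{pr}_1^*\mathrm T^*O_i\otimes\mathrm{pr}_2^*E)$ over $O_i\times M$, i.e. linear maps $A_i(\sigma,m)\colon\mathrm T_\sigma O_i\to E_m$ depending smoothly on $(\sigma,m)$, such that for all $i,j\in I$, $\sigma\in O_i\cap O_j$ and $m\in M$ $$A_i\bigl(\sigma,\beta_{ij}(\sigma)\,\underline\vartriangleright\, m\bigr)=\mathrm T_{\mathrm{Id}_m}C_{\beta_{ij}(\sigma)}\circ A_j(\sigma,m)-\theta_{\mathrm R}\circ\mathrm T_\sigma\bigl(\beta_{ij}(\cdot)(m)\bigr).$$ \textbf{Theorem.} Let $\mathscr P$ be a principaloid $\mathscr G$-bundle over $\Sigma$ and let $\{\tau_i\}_{i\in I}$ be equivariant local trivialisations over an open cover $\{O_i\}_{i\in I}$ of $\Sigma$. Then there is a bijection between the set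 of connection 1-forms $\Theta$ on $\mathscr P$ and the set of local connection data $\{A_i\}_{i\in I}$, under which $\Theta$ and $\{A_i\}_{i\in I}$ correspond to one another if and only if, for all $i\in I$ and $(\sigma,g)\in O_i\times\mathscr G$, $$\bigl((\tau_i^{-1})^{*}\Theta\bigr)(\sigma,g)=\mathrm{id}_{\mathrm T_g\mathscr G}+\mathrm T_{\mathrm{Id}_{t(g)}}r_g\circ A_i\bigl(\sigma,t(g)\bigr),$$ that is, $\mathrm T\tau_i\bigl(\Theta(\mathrm T\tau_i^{-1}(v,V))\bigr)=\bigl(0,\;V+\mathrm T_{\mathrm{Id}_{t(g)}}r_g(A_i(\sigma,t(g))(v))\bigr)$ for all $v\in\mathrm T_\sigma O_i$ and $V\in\mathrm T_g\mathscr G$. -/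

import Mathlib

open Set Manifold Bundle
open scoped ContDiff Topology

noncomputable section

/-! ## Lie groupoids and bisections

Manifolds are smooth, finite-dimensional, without boundary: they are modelled on a finite-dimensional
real normed space `E` through the model with corners `𝓘(ℝ, E)`. -/

/-- A Lie groupoid with manifold of arrows `G` and manifold of objects `M`. The multiplication is
written as a total function, but only its values on the composable pairs `s g = t h` are ever used;
its smoothness is smoothness on the (embedded) submanifold of composable pairs. -/
structure LieGroupoid (EM EG M G : Type*)
    [NormedAddCommGroup EM] [NormedSpace ℝ EM] [NormedAddCommGroup EG] [NormedSpace ℝ EG]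
    [TopologicalSpace M] [ChartedSpace EM M] [TopologicalSpace G] [ChartedSpace EG G] where
  /-- source map -/
  s : G → M
  /-- target map -/
  t : G → M
  /-- unit map -/
  one : M → G
  /-- inverse map -/
  inv : G → G
  /-- multiplication `g.h`, meaningful when `s g = t h` -/
  mul : G → G → G
  s_mul : ∀ g h, s g = t h → s (mul g h) = s h
  t_mul : ∀ g h, s g = t h → t (mul g h) = t g
  mul_assoc : ∀ g h k, s g = t h → s h = t k → mul (mul g h) k = mul g (mul h k)
  s_one : ∀ m, s (one m) = m
  t_one : ∀ m, t (one m) = m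
  one_mul : ∀ g, mul (one (t g)) g = g
  mul_one : ∀ g, mul g (one (s g)) = g
  s_inv : ∀ g, s (inv g) = t g
  t_inv : ∀ g, t (inv g) = s g
  mul_inv : ∀ g, mul g (inv g) = one (t g)
  inv_mul : ∀ g, mul (inv g) g = one (s g)
  surjective_s : Function.Surjective s
  surjective_t : Function.Surjective t
  submersion_s : IsSubmersion 𝓘(ℝ, EG) 𝓘(ℝ, EM) ∞ s
  submersion_t : IsSubmersion 𝓘(ℝ, EG) 𝓘(ℝ, EM) ∞ t
  smooth_s : ContMDiff 𝓘(ℝ, EG) 𝓘(ℝ, EM) ∞ s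
  smooth_t : ContMDiff 𝓘(ℝ, EG) 𝓘(ℝ, EM) ∞ t
  smooth_one : ContMDiff 𝓘(ℝ, EM) 𝓘(ℝ, EG) ∞ one
  smooth_inv : ContMDiff 𝓘(ℝ, EG) 𝓘(ℝ, EG) ∞ inv
  smooth_mul : ContMDiffOn (𝓘(ℝ, EG).prod 𝓘(ℝ, EG)) 𝓘(ℝ, EG) ∞
    (fun p : G × G => mul p.1 p.2) {p | s p.1 = t p.2}

namespace LieGroupoid

variable {EM EG M G : Type*}
  [NormedAddCommGroup EM] [NormedSpace ℝ EM] [NormedAddCommGroup EG] [NormedSpace ℝ EG]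
  [TopologicalSpace M] [ChartedSpace EM M] [TopologicalSpace G] [ChartedSpace EG G]

/-- A global bisection: a smooth section `β` of the source map such that `t ∘ β` is a
diffeomorphism of `M`. -/
structure Bisection (𝒢 : LieGroupoid EM EG M G) where
  toFun : M → G
  smooth : ContMDiff 𝓘(ℝ, EM) 𝓘(ℝ, EG) ∞ toFun
  s_toFun : ∀ m, 𝒢.s (toFun m) = m
  diffeo : ∃ φ : Diffeomorph 𝓘(ℝ, EM) 𝓘(ℝ, EM) M M ∞, ∀ m, φ m = 𝒢.t (toFun m)

variable (𝒢 : LieGroupoid EM EG M G)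

/-- The shadow action of a bisection on objects, `m ↦ t (β m)`. -/
def Bisection.shadow {𝒢 : LieGroupoid EM EG M G} (β : 𝒢.Bisection) (m : M) : M := 𝒢.t (β.toFun m)

/-- The conjugation `C_β : G → G`, `g ↦ β(t g).g.β(s g)⁻¹`. -/
def Bisection.conj {𝒢 : LieGroupoid EM EG M G} (β : 𝒢.Bisection) (g : G) : G :=
  𝒢.mul (𝒢.mul (β.toFun (𝒢.t g)) g) (𝒢.inv (β.toFun (𝒢.s g)))

/-- The fibre at the arrow `g` of the distribution `ker T s`. -/
def kerS (g : G) : Submodule ℝ (TangentSpace 𝓘(ℝ, EG) g) :=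
  LinearMap.ker (mfderiv 𝓘(ℝ, EG) 𝓘(ℝ, EM) 𝒢.s g).toLinearMap

/-- The fibre at the object `m` of the (right tangent) Lie algebroid `E = Id^* ker T s`. -/
abbrev algebroidFibre (m : M) : Submodule ℝ (TangentSpace 𝓘(ℝ, EG) (𝒢.one m)) :=
  𝒢.kerS (𝒢.one m)

/-- The derivative `T_h r_g : (ker T s)_h → T_{h.g} G`, for `s h = t g`, of the right translation
`r_g : h ↦ h.g`, which is defined on the source fibre `s⁻¹(t g)`. A derivative within this source
fibre is unique on the tangent space `(ker T s)_h` of the fibre, and only there, so the map is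
defined exactly on `(ker T s)_h`. -/
def tangentRight (g h : G) :
    𝒢.kerS h →L[ℝ] TangentSpace 𝓘(ℝ, EG) (𝒢.mul h g) :=
  (mfderivWithin 𝓘(ℝ, EG) 𝓘(ℝ, EG) (fun k => 𝒢.mul k g) {k | 𝒢.s k = 𝒢.t g} h).comp
    (𝒢.kerS h).subtypeL

/-- The derivative `T_{Id_m} C_β : E_m → T_{Id_{β ▷ m}} G` of the conjugation, where
`C_β (Id_m) = Id_{β ▷ m}` and `β ▷ m = t (β m)`. -/
def Bisection.tangentConj {𝒢 : LieGroupoid EM EG M G} (β : 𝒢.Bisection) (m : M) :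
    𝒢.algebroidFibre m →L[ℝ] TangentSpace 𝓘(ℝ, EG) (𝒢.one (β.shadow m)) :=
  ContinuousLinearMap.comp (mfderiv 𝓘(ℝ, EG) 𝓘(ℝ, EG) β.conj (𝒢.one m))
    (𝒢.algebroidFibre m).subtypeL

/-- `T_{Id_{t g}} r_g : E_{t g} → T_g G`, where `Id_{t g}.g = g`. -/
def algebroidRight (g : G) : 𝒢.algebroidFibre (𝒢.t g) →L[ℝ] TangentSpace 𝓘(ℝ, EG) g :=
  𝒢.tangentRight g (𝒢.one (𝒢.t g))

/-- The right-invariant Maurer--Cartan form `θ_R(g) = T_g r_{g⁻¹} : (ker T s)_g → T_{Id_{t g}} G`,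
where `g.g⁻¹ = Id_{t g}`. Its values lie in `E_{t g}`. -/
def maurerCartan (g : G) :
    𝒢.kerS g →L[ℝ] TangentSpace 𝓘(ℝ, EG) (𝒢.one (𝒢.t g)) :=
  𝒢.tangentRight (𝒢.inv g) g

end LieGroupoid

/-! ## Principaloid bundles -/

/-- A right module `P` over the Lie groupoid `𝒢` (moment map `μ`, action `p ◂ g` meaningful when
`μ p = t g`), together with a smooth map `π : P → B` whose fibres are preserved by the action. -/
structure FibredModule {EM EG M G : Type*}
    [NormedAddCommGroup EM] [NormedSpace ℝ EM] [NormedAddCommGroup EG] [NormedSpace ℝ EG]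
    [TopologicalSpace M] [ChartedSpace EM M] [TopologicalSpace G] [ChartedSpace EG G]
    (𝒢 : LieGroupoid EM EG M G) (EB EP B P : Type*)
    [NormedAddCommGroup EB] [NormedSpace ℝ EB] [NormedAddCommGroup EP] [NormedSpace ℝ EP]
    [TopologicalSpace B] [ChartedSpace EB B] [TopologicalSpace P] [ChartedSpace EP P] where
  /-- bundle projection -/
  proj : P → B
  /-- moment map -/
  μ : P → M
  /-- action `p ◂ g`, meaningful when `μ p = t g` -/
  act : P → G → P
  μ_act : ∀ p g, μ p = 𝒢.t g → μ (act p g) = 𝒢.s g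
  act_one : ∀ p, act p (𝒢.one (μ p)) = p
  act_act : ∀ p g h, μ p = 𝒢.t g → 𝒢.s g = 𝒢.t h → act (act p g) h = act p (𝒢.mul g h)
  proj_act : ∀ p g, μ p = 𝒢.t g → proj (act p g) = proj p
  smooth_proj : ContMDiff 𝓘(ℝ, EP) 𝓘(ℝ, EB) ∞ proj
  smooth_μ : ContMDiff 𝓘(ℝ, EP) 𝓘(ℝ, EM) ∞ μ
  smooth_act : ContMDiffOn (𝓘(ℝ, EP).prod 𝓘(ℝ, EG)) 𝓘(ℝ, EP) ∞
    (fun q : P × G => act q.1 q.2) {q | μ q.1 = 𝒢.t q.2}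

section Bundles

variable {EM EG M G EB EP B P : Type*}
  [NormedAddCommGroup EM] [NormedSpace ℝ EM] [NormedAddCommGroup EG] [NormedSpace ℝ EG]
  [TopologicalSpace M] [ChartedSpace EM M] [TopologicalSpace G] [ChartedSpace EG G]
  [NormedAddCommGroup EB] [NormedSpace ℝ EB] [NormedAddCommGroup EP] [NormedSpace ℝ EP]
  [TopologicalSpace B] [ChartedSpace EB B] [TopologicalSpace P] [ChartedSpace EP P]
  {𝒢 : LieGroupoid EM EG M G}

/-- A `𝒢`-equivariant local trivialisation `τ : π⁻¹(O) ≅ O × G` over an open set `O = baseSet`: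
a diffeomorphism over `O` that intertwines the moment map with the source map and the action on `P`
with right multiplication in `G`. -/
structure FibredModule.LocalTrivialisation (X : FibredModule 𝒢 EB EP B P)
    extends Trivialization G X.proj where
  smooth_toFun : ContMDiffOn 𝓘(ℝ, EP) (𝓘(ℝ, EB).prod 𝓘(ℝ, EG)) ∞ toOpenPartialHomeomorph source
  smooth_symm : ContMDiffOn (𝓘(ℝ, EB).prod 𝓘(ℝ, EG)) 𝓘(ℝ, EP) ∞
    toOpenPartialHomeomorph.symm target
  μ_symm : ∀ σ ∈ baseSet, ∀ g : G, X.μ (toOpenPartialHomeomorph.symm (σ, g)) = 𝒢.s g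
  act_symm : ∀ σ ∈ baseSet, ∀ g h : G, 𝒢.s g = 𝒢.t h →
    X.act (toOpenPartialHomeomorph.symm (σ, g)) h = toOpenPartialHomeomorph.symm (σ, 𝒢.mul g h)

end Bundles

/-- A principaloid `𝒢`-bundle `P` over `B`: a fibre bundle in right `𝒢`-modules, with fibrewise
action, whose typical fibre is `G` with right multiplication. -/
structure PrincipaloidBundle {EM EG M G : Type*}
    [NormedAddCommGroup EM] [NormedSpace ℝ EM] [NormedAddCommGroup EG] [NormedSpace ℝ EG]
    [TopologicalSpace M] [ChartedSpace EM M] [TopologicalSpace G] [ChartedSpace EG G]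
    (𝒢 : LieGroupoid EM EG M G) (EB EP B P : Type*)
    [NormedAddCommGroup EB] [NormedSpace ℝ EB] [NormedAddCommGroup EP] [NormedSpace ℝ EP]
    [TopologicalSpace B] [ChartedSpace EB B] [TopologicalSpace P] [ChartedSpace EP P]
    extends FibredModule 𝒢 EB EP B P where
  surjective_proj : Function.Surjective proj
  locally_trivial : ∀ σ : B, ∃ τ : toFibredModule.LocalTrivialisation, σ ∈ τ.baseSet

section Connections

variable {EM EG M G EB EP B P : Type*}
  [NormedAddCommGroup EM] [NormedSpace ℝ EM] [NormedAddCommGroup EG] [NormedSpace ℝ EG]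
  [TopologicalSpace M] [ChartedSpace EM M] [TopologicalSpace G] [ChartedSpace EG G]
  [NormedAddCommGroup EB] [NormedSpace ℝ EB] [NormedAddCommGroup EP] [NormedSpace ℝ EP]
  [TopologicalSpace B] [ChartedSpace EB B] [TopologicalSpace P] [ChartedSpace EP P]
  {𝒢 : LieGroupoid EM EG M G}

namespace FibredModule

variable {X : FibredModule 𝒢 EB EP B P}

/-- The map `(σ, m) ↦ β_{τ τ'}(σ)(m)`, read off from the transition map on units:
`τ (τ'⁻¹ (σ, Id_m)) = (σ, β_{τ τ'}(σ)(m))` for `σ` in both base sets. -/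
def transitionArrow (τ τ' : X.LocalTrivialisation) (σ : B) (m : M) : G :=
  (τ.toOpenPartialHomeomorph (τ'.toOpenPartialHomeomorph.symm (σ, 𝒢.one m))).2

namespace LocalTrivialisation

variable (τ τ' : X.LocalTrivialisation) {σ : B}

theorem symm_mem_source (h : σ ∈ τ.baseSet) (h' : σ ∈ τ'.baseSet) (g : G) :
    τ'.toOpenPartialHomeomorph.symm (σ, g) ∈ τ.source := by
  rw [τ.source_eq, mem_preimage]
  have : X.proj (τ'.toOpenPartialHomeomorph.symm (σ, g)) = σ :=
    τ'.toTrivialization.proj_symm_apply' h'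
  rwa [this]

theorem apply_symm_fst (h : σ ∈ τ.baseSet) (h' : σ ∈ τ'.baseSet) (g : G) :
    (τ.toOpenPartialHomeomorph (τ'.toOpenPartialHomeomorph.symm (σ, g))).1 = σ := by
  rw [τ.proj_toFun _ (symm_mem_source τ τ' h h' g)]
  exact τ'.toTrivialization.proj_symm_apply' h'

theorem symm_apply_symm (h : σ ∈ τ.baseSet) (h' : σ ∈ τ'.baseSet) (g : G) :
    τ.toOpenPartialHomeomorph.symm
      (σ, (τ.toOpenPartialHomeomorph (τ'.toOpenPartialHomeomorph.symm (σ, g))).2) =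
      τ'.toOpenPartialHomeomorph.symm (σ, g) := by
  have h1 := τ.toOpenPartialHomeomorph.left_inv (symm_mem_source τ τ' h h' g)
  have h2 := apply_symm_fst τ τ' h h' g
  have h3 : (σ, (τ.toOpenPartialHomeomorph (τ'.toOpenPartialHomeomorph.symm (σ, g))).2) =
      τ.toOpenPartialHomeomorph (τ'.toOpenPartialHomeomorph.symm (σ, g)) := by
    ext1
    · exact h2.symm
    · rfl
  rw [h3, h1]

theorem apply_symm_self (h : σ ∈ τ.baseSet) (g : G) :
    τ.toOpenPartialHomeomorph (τ.toOpenPartialHomeomorph.symm (σ, g)) = (σ, g) :=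
  τ.toTrivialization.apply_symm_apply' h

theorem s_transition (h : σ ∈ τ.baseSet) (h' : σ ∈ τ'.baseSet) (g : G) :
    𝒢.s (τ.toOpenPartialHomeomorph (τ'.toOpenPartialHomeomorph.symm (σ, g))).2 = 𝒢.s g := by
  rw [← τ.μ_symm σ h, symm_apply_symm τ τ' h h', τ'.μ_symm σ h']

theorem s_transitionArrow (h : σ ∈ τ.baseSet) (h' : σ ∈ τ'.baseSet) (m : M) :
    𝒢.s (transitionArrow τ τ' σ m) = m := by
  rw [transitionArrow, s_transition τ τ' h h', 𝒢.s_one]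

/-- The transition map is left multiplication by the transition bisection. -/
theorem apply_symm (h : σ ∈ τ.baseSet) (h' : σ ∈ τ'.baseSet) (g : G) :
    τ.toOpenPartialHomeomorph (τ'.toOpenPartialHomeomorph.symm (σ, g)) =
      (σ, 𝒢.mul (transitionArrow τ τ' σ (𝒢.t g)) g) := by
  have h1 : 𝒢.s (𝒢.one (𝒢.t g)) = 𝒢.t g := 𝒢.s_one _
  have h2 := τ'.act_symm σ h' (𝒢.one (𝒢.t g)) g h1
  rw [𝒢.one_mul, ← symm_apply_symm τ τ' h h' (𝒢.one (𝒢.t g))] at h2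
  rw [← h2, τ.act_symm σ h]
  · rw [apply_symm_self τ h]; rfl
  · rw [s_transition τ τ' h h', h1]

theorem shadow_shadow (h : σ ∈ τ.baseSet) (h' : σ ∈ τ'.baseSet) (m : M) :
    𝒢.t (transitionArrow τ' τ σ (𝒢.t (transitionArrow τ τ' σ m))) = m := by
  have h1 := symm_apply_symm τ τ' h h' (𝒢.one m)
  have h2 := apply_symm τ' τ h' h (transitionArrow τ τ' σ m)
  unfold transitionArrow at h2
  rw [h1, apply_symm_self τ' h'] at h2
  have h3 := congrArg (fun q => 𝒢.t q.2) h2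
  simp only at h3
  rw [𝒢.t_one, 𝒢.t_mul] at h3
  · exact h3.symm
  · exact s_transitionArrow τ' τ h' h _

theorem smooth_transition :
    ContMDiffOn (𝓘(ℝ, EB).prod 𝓘(ℝ, EM)) 𝓘(ℝ, EG) ∞
      (fun q : B × M => transitionArrow τ τ' q.1 q.2) ((τ.baseSet ∩ τ'.baseSet) ×ˢ univ) := by
  have h1 : ContMDiff (𝓘(ℝ, EB).prod 𝓘(ℝ, EM)) (𝓘(ℝ, EB).prod 𝓘(ℝ, EG)) ∞
      (fun q : B × M => (q.1, 𝒢.one q.2)) :=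
    contMDiff_fst.prodMk (𝒢.smooth_one.comp contMDiff_snd)
  have h2 := τ'.smooth_symm.comp (s := (τ.baseSet ∩ τ'.baseSet) ×ˢ univ) h1.contMDiffOn
    (fun q hq => by rw [mem_preimage, τ'.target_eq]; exact ⟨hq.1.2, mem_univ _⟩)
  have h3 := τ.smooth_toFun.comp h2
    (fun q hq => symm_mem_source τ τ' hq.1.1 hq.1.2 (𝒢.one q.2))
  exact contMDiff_snd.comp_contMDiffOn h3

theorem smooth_transition_right (h : σ ∈ τ.baseSet) (h' : σ ∈ τ'.baseSet) :
    ContMDiff 𝓘(ℝ, EM) 𝓘(ℝ, EG) ∞ (transitionArrow τ τ' σ) := by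
  rw [← contMDiffOn_univ]
  exact (smooth_transition τ τ').comp (s := univ)
    (g := fun q : B × M => transitionArrow τ τ' q.1 q.2) (f := fun m : M => (σ, m))
    (contMDiff_const.prodMk contMDiff_id).contMDiffOn
    (fun m _ => ⟨⟨h, h'⟩, mem_univ _⟩)

end LocalTrivialisation

/-- The transition bisection `β_{τ τ'}(σ)`, for `σ` in both base sets. -/
def transition (τ τ' : X.LocalTrivialisation) (σ : B) (h : σ ∈ τ.baseSet) (h' : σ ∈ τ'.baseSet) :
    𝒢.Bisection where
  toFun := transitionArrow τ τ' σ
  smooth := τ.smooth_transition_right τ' h h'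
  s_toFun := τ.s_transitionArrow τ' h h'
  diffeo := by
    refine ⟨⟨⟨fun m => 𝒢.t (transitionArrow τ τ' σ m), fun m => 𝒢.t (transitionArrow τ' τ σ m),
      τ.shadow_shadow τ' h h', τ'.shadow_shadow τ h' h⟩, ?_, ?_⟩, fun m => rfl⟩
    · exact 𝒢.smooth_t.comp (τ.smooth_transition_right τ' h h')
    · exact 𝒢.smooth_t.comp (τ'.smooth_transition_right τ h' h)

/-- The derivative `T_σ (ev_m ∘ β_{τ τ'}) (v)`. -/
def tangentTransition (τ τ' : X.LocalTrivialisation) (σ : B) (m : M)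
    (v : TangentSpace 𝓘(ℝ, EB) σ) : TangentSpace 𝓘(ℝ, EG) (transitionArrow τ τ' σ m) :=
  mfderiv 𝓘(ℝ, EB) 𝓘(ℝ, EG) (fun σ' => transitionArrow τ τ' σ' m) σ v

/-- `T_σ (ev_m ∘ β_{τ τ'})` takes values in `ker T s`, the domain of the Maurer--Cartan form. -/
theorem tangentTransition_mem (τ τ' : X.LocalTrivialisation) (σ : B)
    (h : σ ∈ τ.baseSet) (h' : σ ∈ τ'.baseSet) (m : M) (v : TangentSpace 𝓘(ℝ, EB) σ) :
    tangentTransition τ τ' σ m v ∈ 𝒢.kerS (transitionArrow τ τ' σ m) := by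
  have hO : τ.baseSet ∩ τ'.baseSet ∈ 𝓝 σ :=
    (τ.open_baseSet.inter τ'.open_baseSet).mem_nhds ⟨h, h'⟩
  have h1 : ContMDiffOn 𝓘(ℝ, EB) 𝓘(ℝ, EG) ∞ (fun σ' => transitionArrow τ τ' σ' m)
      (τ.baseSet ∩ τ'.baseSet) :=
    (τ.smooth_transition τ').comp
      (g := fun q : B × M => transitionArrow τ τ' q.1 q.2) (f := fun σ' : B => (σ', m))
      (contMDiff_id.prodMk contMDiff_const).contMDiffOn (fun σ' hσ => ⟨hσ, mem_univ _⟩)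
  have h2 : MDifferentiableAt 𝓘(ℝ, EB) 𝓘(ℝ, EG) (fun σ' => transitionArrow τ τ' σ' m) σ :=
    (h1.contMDiffAt hO).mdifferentiableAt (by simp)
  have h3 : MDifferentiableAt 𝓘(ℝ, EG) 𝓘(ℝ, EM) 𝒢.s (transitionArrow τ τ' σ m) :=
    𝒢.smooth_s.mdifferentiableAt (by simp)
  have h4 := mfderiv_comp σ h3 h2
  have h5 : (𝒢.s ∘ fun σ' => transitionArrow τ τ' σ' m) =ᶠ[𝓝 σ] fun _ => m := by
    filter_upwards [hO] with σ' hσ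
    exact τ.s_transitionArrow τ' hσ.1 hσ.2 m
  rw [h5.mfderiv_eq, mfderiv_const] at h4
  exact (DFunLike.congr_fun h4 v).symm

/-- The pullback `θ_R ∘ T_σ (ev_m ∘ β_{τ τ'})` of the right-invariant Maurer--Cartan form. Its value
lies over `t (β_{τ τ'}(σ)(m)) = β_{τ τ'}(σ) ▷ m`. -/
def transitionMaurerCartan (τ τ' : X.LocalTrivialisation) (σ : B)
    (h : σ ∈ τ.baseSet) (h' : σ ∈ τ'.baseSet) (m : M) (v : TangentSpace 𝓘(ℝ, EB) σ) :
    TangentSpace 𝓘(ℝ, EG) (𝒢.one ((transition τ τ' σ h h').shadow m)) :=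
  𝒢.maurerCartan (transitionArrow τ τ' σ m)
    ⟨tangentTransition τ τ' σ m v, tangentTransition_mem τ τ' σ h h' m v⟩

/-- The vertical space `V_p P = ker T_p π`. -/
def vertical (X : FibredModule 𝒢 EB EP B P) (p : P) : Submodule ℝ (TangentSpace 𝓘(ℝ, EP) p) :=
  LinearMap.ker (mfderiv 𝓘(ℝ, EP) 𝓘(ℝ, EB) X.proj p).toLinearMap

/-- A compatible connection 1-form: a smooth `VP`-valued 1-form `Θ` on `P` (a smooth morphism of
vector bundles `TP → VP` over `P`) such that
* `Θ` restricts to the identity on `VP`;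
* `T μ ∘ Θ = T μ`, i.e. `ker Θ ⊆ ker T μ`;
* `T_p ϱ_g (ker Θ_p) = ker Θ_{p ◂ g}` whenever `μ p = t g`. Here `ϱ_g : p ↦ p ◂ g` is defined on
  the fibre `μ⁻¹(t g)`, and a derivative within this fibre is unique on `ker T_p μ ⊇ ker Θ_p`. -/
@[ext]
structure ConnectionForm [IsManifold 𝓘(ℝ, EP) ∞ P] (X : FibredModule 𝒢 EB EP B P) where
  form : ∀ p : P, TangentSpace 𝓘(ℝ, EP) p →L[ℝ] X.vertical p
  smooth : ContMDiff 𝓘(ℝ, EP).tangent 𝓘(ℝ, EP).tangent ∞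
    (fun w : TangentBundle 𝓘(ℝ, EP) P =>
      (⟨w.proj, (form w.proj w.snd : TangentSpace 𝓘(ℝ, EP) w.proj)⟩ : TangentBundle 𝓘(ℝ, EP) P))
  form_vertical : ∀ (p : P) (w : X.vertical p), form p w = w
  moment : ∀ (p : P) (w : TangentSpace 𝓘(ℝ, EP) p),
    mfderiv 𝓘(ℝ, EP) 𝓘(ℝ, EM) X.μ p (form p w) = mfderiv 𝓘(ℝ, EP) 𝓘(ℝ, EM) X.μ p w
  invariant : ∀ (p : P) (g : G), X.μ p = 𝒢.t g →
    (LinearMap.ker (form p).toLinearMap).map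
      (mfderivWithin 𝓘(ℝ, EP) 𝓘(ℝ, EP) (fun q => X.act q g) {q | X.μ q = 𝒢.t g} p).toLinearMap =
    LinearMap.ker (form (X.act p g)).toLinearMap

open Classical in
/-- Local connection data with respect to a family of local trivialisations `τ i` with base sets
`O i`: smooth `T O_i`-foliated `pr₂^* E`-valued 1-forms `A_i` on `O_i × M`, that is linear maps
`A_i(σ, m) : T_σ B → E_m` for `σ ∈ O_i`, `m ∈ M`, depending smoothly on `(σ, m)` in the sense that
`T O_i × M → T G`, `((σ, v), m) ↦ A_i(σ, m) v` is smooth, subject to the gluing law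
`A_i(σ, β_ij(σ) ▷ m) = T_{Id_m} C_{β_ij(σ)} ∘ A_j(σ, m) - θ_R ∘ T_σ (ev_m ∘ β_ij)`,
an equality in the tangent space at `Id_{β_ij(σ) ▷ m} = C_{β_ij(σ)} (Id_m)`. (The value `0`
in `smooth` is never taken on the set in question.) -/
@[ext]
structure LocalConnectionData [IsManifold 𝓘(ℝ, EB) ∞ B] [IsManifold 𝓘(ℝ, EG) ∞ G]
    (X : FibredModule 𝒢 EB EP B P) {ι : Type*} (τ : ι → X.LocalTrivialisation) where
  form : ∀ (i : ι) (σ : B), σ ∈ (τ i).baseSet → ∀ m : M,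
    TangentSpace 𝓘(ℝ, EB) σ →L[ℝ] 𝒢.algebroidFibre m
  smooth : ∀ i : ι, ContMDiffOn (𝓘(ℝ, EB).tangent.prod 𝓘(ℝ, EM)) 𝓘(ℝ, EG).tangent ∞
    (fun q : TangentBundle 𝓘(ℝ, EB) B × M =>
      (⟨𝒢.one q.2, if h : q.1.proj ∈ (τ i).baseSet then form i q.1.proj h q.2 q.1.snd else 0⟩ :
        TangentBundle 𝓘(ℝ, EG) G))
    {q | q.1.proj ∈ (τ i).baseSet}
  gluing : ∀ (i j : ι) (σ : B) (hi : σ ∈ (τ i).baseSet) (hj : σ ∈ (τ j).baseSet) (m : M)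
    (v : TangentSpace 𝓘(ℝ, EB) σ),
    (form i σ hi ((transition (τ i) (τ j) σ hi hj).shadow m) v :
      TangentSpace 𝓘(ℝ, EG) (𝒢.one ((transition (τ i) (τ j) σ hi hj).shadow m))) =
    (transition (τ i) (τ j) σ hi hj).tangentConj m (form j σ hj m v) -
    transitionMaurerCartan (τ i) (τ j) σ hi hj m v

/-- The relation between a connection 1-form `Θ` and local connection data `A`:
`(τ_i⁻¹)^* Θ (σ, g) = id_{T_g G} + T_{Id_{t g}} r_g ∘ A_i(σ, t g)`, i.e.
`T τ_i (Θ (T τ_i⁻¹ (v, V))) = (0, V + T r_g (A_i(σ, t g) v))`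
for all `i`, `σ ∈ O_i`, `g ∈ G`, `v ∈ T_σ B`, `V ∈ T_g G`. -/
def ConnectionForm.IsPresentedBy [IsManifold 𝓘(ℝ, EP) ∞ P] [IsManifold 𝓘(ℝ, EB) ∞ B]
    [IsManifold 𝓘(ℝ, EG) ∞ G] {X : FibredModule 𝒢 EB EP B P} {ι : Type*}
    {τ : ι → X.LocalTrivialisation} (Θ : X.ConnectionForm) (A : X.LocalConnectionData τ) : Prop :=
  ∀ (i : ι) (σ : B) (hσ : σ ∈ (τ i).baseSet) (g : G)
    (v : TangentSpace 𝓘(ℝ, EB) σ) (V : TangentSpace 𝓘(ℝ, EG) g),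
    mfderiv 𝓘(ℝ, EP) (𝓘(ℝ, EB).prod 𝓘(ℝ, EG)) (τ i).toOpenPartialHomeomorph
      ((τ i).toOpenPartialHomeomorph.symm (σ, g))
      (Θ.form ((τ i).toOpenPartialHomeomorph.symm (σ, g))
        (mfderiv (𝓘(ℝ, EB).prod 𝓘(ℝ, EG)) 𝓘(ℝ, EP) (τ i).toOpenPartialHomeomorph.symm (σ, g)
          (v, V))) =
    ((0, V + 𝒢.algebroidRight g (A.form i σ hσ (𝒢.t g) v)) :
      TangentSpace 𝓘(ℝ, EB) σ × TangentSpace 𝓘(ℝ, EG) g)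

end FibredModule

end Connections

end

/-! In a trivialisation `τ`, a form that is the identity on vertical vectors has the shape `(v, V) ↦
(0, V + a(σ, g) v)`, so it is determined by its horizontal part `a(σ, g) : T_σ B → T_g G`, called
`localForm` below. The axioms of a connection translate into conditions on `a`. Compatibility with
the moment map says that `a(σ, g)` takes values in `ker T_g s`, because `μ` becomes `s` in the
trivialisation. The kernel of the form is the graph of `-a(σ, g)`, so invariance under `ϱ_h` says `T
r_h ∘ a(σ, g) = a(σ, g.h)`. Hence `a` is determined by its values along the units: `a(σ, g) = T r_g
∘ A(σ, t g)` with `A(σ, m) = a(σ, Id_m)`.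

The transition map is `(σ, g) ↦ (σ, β(σ)(t g).g)`, with derivative computed in
`deriv_invDeriv_transition`. Two families `a_i`, `a_j` describe the same form exactly when they
satisfy the identity in `localForm_transition`. At `g = Id_m` this identity is the gluing law after
right translation by `β(σ)(m)⁻¹` (`gluing_iff`), and right translation carries it from the units to
every arrow (`gluing_right`). So local data yield a well-defined global form (`lift_eq_lift`), and a
form yields local data.

There are two analytic difficulties. Right translation lives only on a source fibre, and a
derivative within that fibre is determined only on `ker T s`. Vectors in `ker T s` are therefore
realised as velocities of maps into the fibre, obtained from a smooth retraction onto the fibres of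
the submersion `s`, and every identity of right translations follows from the chain rule along such
a map. Smoothness of `(g, a) ↦ T r_g a` follows by extending the multiplication smoothly to an open
subset of `G × G` with the same retraction.

Derivatives are treated as linear maps between model spaces, which avoids transport between tangent
spaces at points that are equal only by a proof. -/

noncomputable section

/-! ### Chain rule within a subset, and smooth maps into tangent bundles -/

section Manifolds

variable {E E' E'' X Y N : Type*}
  [NormedAddCommGroup E] [NormedSpace ℝ E] [NormedAddCommGroup E'] [NormedSpace ℝ E']
  [NormedAddCommGroup E''] [NormedSpace ℝ E'']
  {H H' H'' : Type*} [TopologicalSpace H] [TopologicalSpace H'] [TopologicalSpace H'']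
  {I : ModelWithCorners ℝ E H} {J : ModelWithCorners ℝ E' H'} {K : ModelWithCorners ℝ E'' H''}
  [TopologicalSpace X] [ChartedSpace H X] [TopologicalSpace Y] [ChartedSpace H' Y]
  [TopologicalSpace N] [ChartedSpace H'' N]

/-- The chain rule for a derivative within a set `S` along a map that takes values in `S` near the
point in question. -/
theorem mfderiv_comp_of_eventually_mem {f : X → Y} {S : Set X} {c : N → X} {y : N}
    (hf : MDifferentiableWithinAt I J f S (c y)) (hc : MDifferentiableAt K I c y)
    (hS : ∀ᶠ z in 𝓝 y, c z ∈ S) (u : TangentSpace K y) :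
    mfderiv K J (fun z => f (c z)) y u = mfderivWithin I J f S (c y) (mfderiv K I c y u) := by
  have h1 : HasMFDerivWithinAt K I c {z | c z ∈ S} y (mfderiv K I c y) :=
    hc.hasMFDerivAt.hasMFDerivWithinAt
  have h2 := HasMFDerivWithinAt.comp y hf.hasMFDerivWithinAt h1 (fun z hz => hz)
  have h3 := h2.hasMFDerivAt hS
  exact DFunLike.congr_fun h3.mfderiv u

theorem IsOpen.contMDiffOn_tangentMap [IsManifold I 1 X] [IsManifold J 1 Y] {f : X → Y} {S : Set X}
    (hS : IsOpen S) (hf : ContMDiffOn I J ∞ f S) :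
    ContMDiffOn I.tangent J.tangent ∞ (tangentMap I J f) {w | w.proj ∈ S} := by
  refine (hf.contMDiffOn_tangentMapWithin (m := ∞) (by simp) hS.uniqueMDiffOn).congr ?_
  intro w hw
  exact (tangentMapWithin_eq_tangentMap (hS.uniqueMDiffOn _ hw)
    ((hf.contMDiffAt (hS.mem_nhds hw)).mdifferentiableAt (by simp))).symm

theorem ContMDiffOn.tangentProdMk [IsManifold I 1 X] [IsManifold J 1 Y]
    {u : N → TangentBundle I X} {w : N → TangentBundle J Y} {S : Set N}
    (hu : ContMDiffOn K I.tangent ∞ u S) (hw : ContMDiffOn K J.tangent ∞ w S) :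
    ContMDiffOn K (I.prod J).tangent ∞
      (fun z => (⟨((u z).proj, (w z).proj), ((u z).snd, (w z).snd)⟩ :
        TangentBundle (I.prod J) (X × Y))) S :=
  (contMDiff_equivTangentBundleProd_symm (I := I) (I' := J) (M := X) (M' := Y)).comp_contMDiffOn
    (hu.prodMk hw)

/-- A trivialisation of the tangent bundle around `f z` is linear on fibres, so in it the sum
becomes a sum of two smooth functions with values in the model space. -/
theorem ContMDiffOn.tangentAdd [IsManifold I 1 X] {f : N → X}
    {a b : ∀ z, TangentSpace I (f z)} {S : Set N}
    (ha : ContMDiffOn K I.tangent ∞ (fun z => (⟨f z, a z⟩ : TangentBundle I X)) S)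
    (hb : ContMDiffOn K I.tangent ∞ (fun z => (⟨f z, b z⟩ : TangentBundle I X)) S) :
    ContMDiffOn K I.tangent ∞ (fun z => (⟨f z, a z + b z⟩ : TangentBundle I X)) S := by
  intro z hz
  have h1 := (Bundle.contMDiffWithinAt_totalSpace).1 (ha z hz)
  have h2 := (Bundle.contMDiffWithinAt_totalSpace).1 (hb z hz)
  refine (Bundle.contMDiffWithinAt_totalSpace).2 ⟨h1.1, ?_⟩
  have h3 : (fun y => f y) ⁻¹' (trivializationAt E (TangentSpace I) (f z)).baseSet ∈ 𝓝[S] z :=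
    h1.1.continuousWithinAt.preimage_mem_nhdsWithin
      ((trivializationAt E (TangentSpace I) (f z)).open_baseSet.mem_nhds
        (FiberBundle.mem_baseSet_trivializationAt' (f z)))
  refine (h1.2.add h2.2).congr_of_eventuallyEq_of_mem ?_ hz
  filter_upwards [h3] with y hy
  exact ((trivializationAt E (TangentSpace I) (f z)).linear ℝ hy).1 (a y) (b y)

theorem ContMDiffOn.tangentZero [IsManifold I 1 X] {f : N → X} {S : Set N}
    (hf : ContMDiffOn K I ∞ f S) :
    ContMDiffOn K I.tangent ∞ (fun z => (⟨f z, 0⟩ : TangentBundle I X)) S :=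
  (Bundle.contMDiff_zeroSection ℝ (TangentSpace I : X → Type _)).comp_contMDiffOn hf

end Manifolds

/-! ### Retractions onto the fibres of a submersion -/

section Submersions

variable {E E' X Y : Type*}
  [NormedAddCommGroup E] [NormedSpace ℝ E] [NormedAddCommGroup E'] [NormedSpace ℝ E']
  [TopologicalSpace X] [ChartedSpace E X] [TopologicalSpace Y] [ChartedSpace E' Y]

/-- Near a point of its domain, a submersion `f` admits a smooth family of retractions onto its
fibres. -/
theorem Manifold.IsSubmersion.exists_fibre_retraction {f : X → Y}
    (hf : IsSubmersion 𝓘(ℝ, E) 𝓘(ℝ, E') ∞ f) (x : X) :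
    ∃ (ρ : X × Y → X) (U : Set (X × Y)), IsOpen U ∧ (x, f x) ∈ U ∧
      ContMDiffOn (𝓘(ℝ, E).prod 𝓘(ℝ, E')) 𝓘(ℝ, E) ∞ ρ U ∧ (∀ q ∈ U, f (ρ q) = q.2) ∧
      ∀ y, (y, f y) ∈ U → ρ (y, f y) = y := by
  have h := (hf.isSubmersionAt x)
  set φ := h.domChart.extend 𝓘(ℝ, E) with hφ
  set ψ := h.codChart.extend 𝓘(ℝ, E') with hψ
  have hφs : φ.source = h.domChart.source := h.domChart.extend_source
  have hψs : ψ.source = h.codChart.source := h.codChart.extend_source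
  have hφo : IsOpen φ.source := by rw [hφs]; exact h.domChart.open_source
  have hψo : IsOpen ψ.source := by rw [hψs]; exact h.codChart.open_source
  have hφt : IsOpen φ.target := h.domChart.isOpen_extend_target
  have hw : ∀ z ∈ φ.target, ψ (f (φ.symm z)) = (h.equiv z).1 := fun z hz => h.writtenInCharts hz
  have hmaps : ∀ y ∈ φ.source, f y ∈ ψ.source := by
    intro y hy
    rw [hψs]
    exact h.source_subset_preimage_source (hφs ▸ hy)
  have hw' : ∀ y ∈ φ.source, (h.equiv (φ y)).1 = ψ (f y) := by
    intro y hy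
    rw [← hw _ (φ.map_source hy), φ.left_inv hy]
  -- In adapted charts `f` is the projection to the first factor of `E' × h.complement`. Keeping the
  -- complementary coordinate of `q.1` and replacing the first one by that of `q.2` moves `q.1` into
  -- the fibre over `q.2`.
  set j : X × Y → E := fun q => h.equiv.symm (ψ q.2, (h.equiv (φ q.1)).2) with hj
  have hjs : ContMDiffOn (𝓘(ℝ, E).prod 𝓘(ℝ, E')) 𝓘(ℝ, E) ∞ j (φ.source ×ˢ ψ.source) := by
    have h1 : ContMDiffOn (𝓘(ℝ, E).prod 𝓘(ℝ, E')) 𝓘(ℝ, E) ∞ (fun q : X × Y => φ q.1)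
        (φ.source ×ˢ ψ.source) := by
      have := h.domChart.contMDiffOn_extend h.domChart_mem_maximalAtlas
      rw [← hφs] at this
      exact this.comp contMDiff_fst.contMDiffOn (fun q hq => hq.1)
    have h2 : ContMDiffOn (𝓘(ℝ, E).prod 𝓘(ℝ, E')) 𝓘(ℝ, E') ∞ (fun q : X × Y => ψ q.2)
        (φ.source ×ˢ ψ.source) := by
      have := h.codChart.contMDiffOn_extend h.codChart_mem_maximalAtlas
      rw [← hψs] at this
      exact this.comp contMDiff_snd.contMDiffOn (fun q hq => hq.2)
    have h3 : ContMDiff 𝓘(ℝ, E) 𝓘(ℝ, h.complement) ∞ (fun z => (h.equiv z).2) :=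
      ((ContinuousLinearMap.snd ℝ E' h.complement).comp
        (h.equiv : E →L[ℝ] E' × h.complement)).contMDiff
    exact ((h.equiv.symm : E' × h.complement →L[ℝ] E).contMDiff).comp_contMDiffOn
      (h2.prodMk_space (h3.comp_contMDiffOn h1))
  have hjd : ∀ y ∈ φ.source, j (y, f y) = φ y := by
    intro y hy
    rw [hj]
    simp only
    rw [← hw' y hy]
    exact h.equiv.symm_apply_apply _
  refine ⟨fun q => φ.symm (j q), (φ.source ×ˢ ψ.source) ∩ j ⁻¹' φ.target,
    hjs.continuousOn.isOpen_inter_preimage (hφo.prod hψo) hφt, ?_, ?_, ?_, ?_⟩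
  · have hx : x ∈ φ.source := by rw [hφs]; exact h.mem_domChart_source
    refine ⟨⟨hx, hmaps x hx⟩, ?_⟩
    rw [mem_preimage, hjd x hx]
    exact φ.map_source hx
  · have h1 : ContMDiffOn 𝓘(ℝ, E) 𝓘(ℝ, E) ∞ φ.symm φ.target := by
      have := contMDiffOn_extend_symm (I := 𝓘(ℝ, E)) h.domChart_mem_maximalAtlas
      rwa [← h.domChart.extend_target'] at this
    exact h1.comp (hjs.mono inter_subset_left) (fun q hq => hq.2)
  · intro q hq
    refine ψ.injOn (hmaps _ (φ.map_target hq.2)) hq.1.2 ?_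
    rw [hw _ hq.2, hj]
    simp only [ContinuousLinearEquiv.apply_symm_apply]
  · intro y hy
    exact (congrArg φ.symm (hjd y hy.1.1)).trans (φ.left_inv hy.1.1)

/-- For a submersion `f` and a point `x`, there is a smooth germ of a retraction onto the fibre
through `x`, and its derivative is the identity on `ker T_x f`. -/
theorem Manifold.IsSubmersion.exists_retraction [IsManifold 𝓘(ℝ, E) 1 X] {f : X → Y}
    (hf : IsSubmersion 𝓘(ℝ, E) 𝓘(ℝ, E') ∞ f) (hf' : ContMDiff 𝓘(ℝ, E) 𝓘(ℝ, E') ∞ f) (x : X) :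
    ∃ c : X → X, ContMDiffAt 𝓘(ℝ, E) 𝓘(ℝ, E) ∞ c x ∧ c x = x ∧ (∀ᶠ y in 𝓝 x, f (c y) = f x) ∧
      ∀ v : TangentSpace 𝓘(ℝ, E) x, mfderiv 𝓘(ℝ, E) 𝓘(ℝ, E') f x v = 0 →
        mfderiv 𝓘(ℝ, E) 𝓘(ℝ, E) c x v = v := by
  obtain ⟨ρ, U, hU, hxU, hρ, hfρ, hρf⟩ := hf.exists_fibre_retraction x
  have hρx := hρ.contMDiffAt (hU.mem_nhds hxU)
  have hj : ContMDiffAt 𝓘(ℝ, E) (𝓘(ℝ, E).prod 𝓘(ℝ, E')) ∞ (fun y => (y, f x)) x :=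
    contMDiffAt_id.prodMk contMDiffAt_const
  have hg : ContMDiffAt 𝓘(ℝ, E) (𝓘(ℝ, E).prod 𝓘(ℝ, E')) ∞ (fun y => (y, f y)) x :=
    contMDiffAt_id.prodMk hf'.contMDiffAt
  refine ⟨fun y => ρ (y, f x), ContMDiffAt.comp x hρx hj, hρf x hxU, ?_, ?_⟩
  · filter_upwards [hj.continuousAt.preimage_mem_nhds (hU.mem_nhds hxU)] with y hy
    exact hfρ _ hy
  · intro v hv
    have hd := hρx.mdifferentiableAt (by simp)
    -- The maps `y ↦ ρ (y, f x)` and `y ↦ ρ (y, f y)` have derivatives `Tρ (v, 0)` and `Tρ (v, Tf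
    -- v)`. These agree when `Tf v = 0`, and the second map is the identity near `x`.
    have h1 : mfderiv 𝓘(ℝ, E) 𝓘(ℝ, E) (fun y => ρ (y, f x)) x v =
        mfderiv (𝓘(ℝ, E).prod 𝓘(ℝ, E')) 𝓘(ℝ, E) ρ (x, f x)
          ((v, 0) : TangentSpace 𝓘(ℝ, E) x × TangentSpace 𝓘(ℝ, E') (f x)) :=
      (mfderiv_comp_apply x hd (hj.mdifferentiableAt (by simp)) v).trans
        (congrArg _ (DFunLike.congr_fun mfderiv_prod_left v))
    have h2 : mfderiv 𝓘(ℝ, E) 𝓘(ℝ, E) (fun y => ρ (y, f y)) x v =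
        mfderiv (𝓘(ℝ, E).prod 𝓘(ℝ, E')) 𝓘(ℝ, E) ρ (x, f x) (v, mfderiv 𝓘(ℝ, E) 𝓘(ℝ, E') f x v) :=
      (mfderiv_comp_apply x hd (hg.mdifferentiableAt (by simp)) v).trans
        (congrArg _ (DFunLike.congr_fun (mfderiv_prodMk mdifferentiableAt_id
          (hf'.mdifferentiableAt (by simp))) v |>.trans
            (Prod.ext (DFunLike.congr_fun mfderiv_id v) rfl)))
    have h3 : (fun y => ρ (y, f y)) =ᶠ[𝓝 x] id := by
      filter_upwards [hg.continuousAt.preimage_mem_nhds (hU.mem_nhds hxU)] with y hy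
      exact hρf y hy
    have h4 : mfderiv 𝓘(ℝ, E) 𝓘(ℝ, E) (fun y => ρ (y, f y)) x v = v :=
      (DFunLike.congr_fun h3.mfderiv_eq v).trans (DFunLike.congr_fun mfderiv_id v)
    rw [hv] at h2
    exact h1.trans (h2.symm.trans h4)

end Submersions

/-- Every tangent space is by definition the model space, so base points and vectors can be compared
separately, without a heterogeneous equality. -/
theorem TangentBundle.mk_eq_mk {E X : Type*} [NormedAddCommGroup E] [NormedSpace ℝ E]
    [TopologicalSpace X] [ChartedSpace E X] {x y : X} {v w : E} (h : x = y) (h' : v = w) :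
    (⟨x, v⟩ : TangentBundle 𝓘(ℝ, E) X) = ⟨y, w⟩ := by
  subst h; subst h'; rfl

/-! ### Derivatives of right translations along source fibres -/

namespace LieGroupoid

variable {EM EG EN M G N : Type*}
  [NormedAddCommGroup EM] [NormedSpace ℝ EM] [NormedAddCommGroup EG] [NormedSpace ℝ EG]
  [NormedAddCommGroup EN] [NormedSpace ℝ EN] {HN : Type*} [TopologicalSpace HN]
  {K : ModelWithCorners ℝ EN HN}
  [TopologicalSpace M] [ChartedSpace EM M] [TopologicalSpace G] [ChartedSpace EG G]
  [TopologicalSpace N] [ChartedSpace HN N]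
  (𝒢 : LieGroupoid EM EG M G)

/-- The derivative at `h` of the right translation `k ↦ k.g` along the source fibre `s⁻¹(t g)`, as a
linear map between model spaces. -/
def rightDeriv (g h : G) : EG →L[ℝ] EG :=
  mfderivWithin 𝓘(ℝ, EG) 𝓘(ℝ, EG) (fun k => 𝒢.mul k g) {k | 𝒢.s k = 𝒢.t g} h

/-- The derivative of the source map, as a linear map between model spaces. -/
def sourceDeriv (g : G) : EG →L[ℝ] EM := mfderiv 𝓘(ℝ, EG) 𝓘(ℝ, EM) 𝒢.s g

variable {𝒢}

theorem mdifferentiableAt_s (g : G) : MDifferentiableAt 𝓘(ℝ, EG) 𝓘(ℝ, EM) 𝒢.s g :=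
  𝒢.smooth_s.mdifferentiableAt (by simp)

/-- The base point `g` is kept apart from `c y`, so that the result applies when `c y` is only
provably equal to the arrow in view. -/
theorem sourceDeriv_mfderiv_of_comp_eq {c : N → G} {f : N → M} {y : N} {g : G} (hy : c y = g)
    (hc : MDifferentiableAt K 𝓘(ℝ, EG) c y) (hs : ∀ᶠ z in 𝓝 y, 𝒢.s (c z) = f z)
    (u : TangentSpace K y) :
    𝒢.sourceDeriv g (mfderiv K 𝓘(ℝ, EG) c y u) = mfderiv K 𝓘(ℝ, EM) f y u := by
  subst hy
  have h1 := mfderiv_comp_apply y (𝒢.mdifferentiableAt_s (c y)) hc u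
  have h2 : (𝒢.s ∘ c) =ᶠ[𝓝 y] f := hs
  exact h1.symm.trans (DFunLike.congr_fun h2.mfderiv_eq u)

theorem sourceDeriv_mfderiv_of_eventually_eq {c : N → G} {y : N} {g : G} {m : M} (hy : c y = g)
    (hc : MDifferentiableAt K 𝓘(ℝ, EG) c y) (hs : ∀ᶠ z in 𝓝 y, 𝒢.s (c z) = m)
    (u : TangentSpace K y) : 𝒢.sourceDeriv g (mfderiv K 𝓘(ℝ, EG) c y u) = 0 :=
  (sourceDeriv_mfderiv_of_comp_eq hy hc hs u).trans (DFunLike.congr_fun mfderiv_const u)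

theorem contMDiffOn_mul_right (g : G) :
    ContMDiffOn 𝓘(ℝ, EG) 𝓘(ℝ, EG) ∞ (fun k => 𝒢.mul k g) {k | 𝒢.s k = 𝒢.t g} :=
  𝒢.smooth_mul.comp (f := fun k : G => (k, g)) (contMDiff_id.prodMk contMDiff_const).contMDiffOn
    (fun _ hk => hk)

theorem contMDiffAt_mul_right {c : N → G} {y : N} (g : G)
    (hc : ContMDiffAt K 𝓘(ℝ, EG) ∞ c y) (hs : ∀ᶠ z in 𝓝 y, 𝒢.s (c z) = 𝒢.t g) :
    ContMDiffAt K 𝓘(ℝ, EG) ∞ (fun z => 𝒢.mul (c z) g) y := by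
  have h1 := ContMDiffWithinAt.comp y (𝒢.contMDiffOn_mul_right g (c y) hs.self_of_nhds)
    (hc.contMDiffWithinAt (s := {z | 𝒢.s (c z) = 𝒢.t g})) (fun z hz => hz)
  exact h1.contMDiffAt hs

theorem mfderiv_mul_right {c : N → G} {y : N} {g h : G} (hy : c y = h)
    (hc : MDifferentiableAt K 𝓘(ℝ, EG) c y) (hs : ∀ᶠ z in 𝓝 y, 𝒢.s (c z) = 𝒢.t g)
    (u : TangentSpace K y) :
    mfderiv K 𝓘(ℝ, EG) (fun z => 𝒢.mul (c z) g) y u =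
      𝒢.rightDeriv g h (mfderiv K 𝓘(ℝ, EG) c y u) := by
  subst hy
  exact mfderiv_comp_of_eventually_mem
    ((𝒢.contMDiffOn_mul_right g (c y) hs.self_of_nhds).mdifferentiableWithinAt (by simp)) hc hs u

section

variable [IsManifold 𝓘(ℝ, EG) 1 G]

variable (𝒢) in
/-- Vectors in `ker T_h s` are velocities of germs of maps into the source fibre of `h`. -/
theorem exists_source_retraction (h : G) :
    ∃ c : G → G, ContMDiffAt 𝓘(ℝ, EG) 𝓘(ℝ, EG) ∞ c h ∧ c h = h ∧
      (∀ᶠ k in 𝓝 h, 𝒢.s (c k) = 𝒢.s h) ∧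
      ∀ v : EG, 𝒢.sourceDeriv h v = 0 → mfderiv 𝓘(ℝ, EG) 𝓘(ℝ, EG) c h v = v :=
  𝒢.submersion_s.exists_retraction 𝒢.smooth_s h

/-- Right translation by `g` maps the source fibre over `t g` into the one over `s g`. The
hypothesis on `v` is essential: off `ker T s` the value of `rightDeriv` is an arbitrary choice. -/
theorem sourceDeriv_rightDeriv {g h : G} (hgh : 𝒢.s h = 𝒢.t g) {v : EG}
    (hv : 𝒢.sourceDeriv h v = 0) : 𝒢.sourceDeriv (𝒢.mul h g) (𝒢.rightDeriv g h v) = 0 := by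
  obtain ⟨c, hc, hch, hs, hcv⟩ := 𝒢.exists_source_retraction h
  rw [hgh] at hs
  have h1 := mfderiv_mul_right hch (hc.mdifferentiableAt (by simp)) hs v
  have h2 : 𝒢.rightDeriv g h v = mfderiv 𝓘(ℝ, EG) 𝓘(ℝ, EG) (fun z => 𝒢.mul (c z) g) h v :=
    (congrArg (𝒢.rightDeriv g h) (hcv v hv)).symm.trans h1.symm
  refine (congrArg (𝒢.sourceDeriv (𝒢.mul h g)) h2).trans ?_
  refine sourceDeriv_mfderiv_of_eventually_eq (m := 𝒢.s g) (by simp only [hch])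
    ((contMDiffAt_mul_right g hc hs).mdifferentiableAt (by simp)) ?_ v
  filter_upwards [hs] with z hz
  exact 𝒢.s_mul _ _ hz

/-- Associativity, differentiated along a germ of maps into the source fibre of `h` whose derivative
fixes `v`. -/
theorem rightDeriv_rightDeriv {g g' h : G} (hgh : 𝒢.s h = 𝒢.t g) (hgg : 𝒢.s g = 𝒢.t g') {v : EG}
    (hv : 𝒢.sourceDeriv h v = 0) :
    𝒢.rightDeriv g' (𝒢.mul h g) (𝒢.rightDeriv g h v) = 𝒢.rightDeriv (𝒢.mul g g') h v := by
  obtain ⟨c, hc, hch, hs, hcv⟩ := 𝒢.exists_source_retraction h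
  rw [hgh] at hs
  have h1 := mfderiv_mul_right hch (hc.mdifferentiableAt (by simp)) hs v
  have h2 := mfderiv_mul_right (g := 𝒢.mul g g') hch (hc.mdifferentiableAt (by simp))
    (by filter_upwards [hs] with z hz; rw [hz, 𝒢.t_mul _ _ hgg]) v
  have hs' : ∀ᶠ z in 𝓝 h, 𝒢.s (𝒢.mul (c z) g) = 𝒢.t g' := by
    filter_upwards [hs] with z hz
    rw [𝒢.s_mul _ _ hz, hgg]
  have h3 := mfderiv_mul_right (c := fun z => 𝒢.mul (c z) g) (h := 𝒢.mul h g) (by simp only [hch])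
    ((contMDiffAt_mul_right g hc hs).mdifferentiableAt (by simp)) hs' v
  have h4 : (fun z => 𝒢.mul (𝒢.mul (c z) g) g') =ᶠ[𝓝 h] fun z => 𝒢.mul (c z) (𝒢.mul g g') := by
    filter_upwards [hs] with z hz
    exact 𝒢.mul_assoc _ _ _ hz hgg
  have h5 := congrArg (𝒢.rightDeriv g h) (hcv v hv)
  have h6 := congrArg (𝒢.rightDeriv (𝒢.mul g g') h) (hcv v hv)
  exact (congrArg (𝒢.rightDeriv g' (𝒢.mul h g)) (h5.symm.trans h1.symm)).trans
    (h3.symm.trans ((DFunLike.congr_fun h4.mfderiv_eq v).trans (h2.trans h6)))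

theorem rightDeriv_one {h : G} {m : M} (hm : 𝒢.s h = m) {v : EG} (hv : 𝒢.sourceDeriv h v = 0) :
    𝒢.rightDeriv (𝒢.one m) h v = v := by
  subst hm
  obtain ⟨c, hc, hch, hs, hcv⟩ := 𝒢.exists_source_retraction h
  have h1 := mfderiv_mul_right (g := 𝒢.one (𝒢.s h)) hch (hc.mdifferentiableAt (by simp))
    (by rwa [𝒢.t_one]) v
  have h2 : (fun z => 𝒢.mul (c z) (𝒢.one (𝒢.s h))) =ᶠ[𝓝 h] c := by
    filter_upwards [hs] with z hz
    rw [← hz, 𝒢.mul_one]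
  exact (congrArg (𝒢.rightDeriv (𝒢.one (𝒢.s h)) h) (hcv v hv)).symm.trans
    (h1.symm.trans ((DFunLike.congr_fun h2.mfderiv_eq v).trans (hcv v hv)))

/-- With `rightDeriv_rightDeriv_inv`, this makes right translation an isomorphism between the spaces
`ker T s`, which is what allows the inverse arrow to be removed from the gluing law. -/
theorem rightDeriv_inv_rightDeriv {g h : G} (hgh : 𝒢.s h = 𝒢.t g) {v : EG}
    (hv : 𝒢.sourceDeriv h v = 0) :
    𝒢.rightDeriv (𝒢.inv g) (𝒢.mul h g) (𝒢.rightDeriv g h v) = v := by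
  rw [rightDeriv_rightDeriv hgh (𝒢.t_inv g).symm hv, 𝒢.mul_inv, rightDeriv_one hgh hv]

theorem rightDeriv_rightDeriv_inv {g h : G} (hgh : 𝒢.s h = 𝒢.s g) {v : EG}
    (hv : 𝒢.sourceDeriv h v = 0) :
    𝒢.rightDeriv g (𝒢.mul h (𝒢.inv g)) (𝒢.rightDeriv (𝒢.inv g) h v) = v := by
  rw [rightDeriv_rightDeriv (hgh.trans (𝒢.t_inv g).symm) (𝒢.s_inv g) hv, 𝒢.inv_mul,
    rightDeriv_one hgh hv]

end

/-! ### Left multiplication and conjugation by a bisection -/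

/-- Left multiplication by a bisection, `g ↦ β(t g).g`. -/
def Bisection.left (β : 𝒢.Bisection) (g : G) : G := 𝒢.mul (β.toFun (𝒢.t g)) g

namespace Bisection

variable (β : 𝒢.Bisection)

theorem s_left (g : G) : 𝒢.s (β.left g) = 𝒢.s g := 𝒢.s_mul _ _ (β.s_toFun _)

theorem t_left (g : G) : 𝒢.t (β.left g) = β.shadow (𝒢.t g) := 𝒢.t_mul _ _ (β.s_toFun _)

theorem left_one (m : M) : β.left (𝒢.one m) = β.toFun m := by
  have h := 𝒢.mul_one (β.toFun m)
  rw [β.s_toFun] at h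
  rw [left, 𝒢.t_one, h]

theorem left_mul {g h : G} (hgh : 𝒢.s g = 𝒢.t h) : β.left (𝒢.mul g h) = 𝒢.mul (β.left g) h := by
  rw [left, left, 𝒢.t_mul _ _ hgh, 𝒢.mul_assoc _ _ _ (β.s_toFun _) hgh]

theorem conj_eq (g : G) : β.conj g = 𝒢.mul (β.left g) (𝒢.inv (β.toFun (𝒢.s g))) := rfl

theorem contMDiff_left : ContMDiff 𝓘(ℝ, EG) 𝓘(ℝ, EG) ∞ β.left := by
  rw [← contMDiffOn_univ]
  exact 𝒢.smooth_mul.comp (f := fun g : G => (β.toFun (𝒢.t g), g))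
    ((β.smooth.comp 𝒢.smooth_t).prodMk contMDiff_id).contMDiffOn (fun g _ => β.s_toFun _)

theorem contMDiff_conj : ContMDiff 𝓘(ℝ, EG) 𝓘(ℝ, EG) ∞ β.conj := by
  rw [← contMDiffOn_univ]
  refine 𝒢.smooth_mul.comp (f := fun g : G => (β.left g, 𝒢.inv (β.toFun (𝒢.s g))))
    (β.contMDiff_left.prodMk
      (𝒢.smooth_inv.comp (β.smooth.comp 𝒢.smooth_s))).contMDiffOn (fun g _ => ?_)
  show 𝒢.s (β.left g) = 𝒢.t (𝒢.inv (β.toFun (𝒢.s g)))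
  rw [β.s_left, 𝒢.t_inv, β.s_toFun]

/-- The derivative of the left multiplication by a bisection, as a linear map between model
spaces. -/
def leftDeriv (g : G) : EG →L[ℝ] EG := mfderiv 𝓘(ℝ, EG) 𝓘(ℝ, EG) β.left g

/-- The derivative of the conjugation at a unit, as a linear map between model spaces. -/
def conjDeriv (m : M) : EG →L[ℝ] EG := mfderiv 𝓘(ℝ, EG) 𝓘(ℝ, EG) β.conj (𝒢.one m)

theorem mdifferentiableAt_left (g : G) : MDifferentiableAt 𝓘(ℝ, EG) 𝓘(ℝ, EG) β.left g :=
  β.contMDiff_left.mdifferentiableAt (by simp)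

theorem sourceDeriv_leftDeriv (g : G) (v : EG) :
    𝒢.sourceDeriv (β.left g) (β.leftDeriv g v) = 𝒢.sourceDeriv g v :=
  sourceDeriv_mfderiv_of_comp_eq rfl (β.mdifferentiableAt_left g)
    (Filter.Eventually.of_forall β.s_left) v

theorem mfderiv_left_comp {c : N → G} {y : N} {g : G} (hy : c y = g)
    (hc : MDifferentiableAt K 𝓘(ℝ, EG) c y) (u : TangentSpace K y) :
    mfderiv K 𝓘(ℝ, EG) (fun z => β.left (c z)) y u =
      β.leftDeriv g (mfderiv K 𝓘(ℝ, EG) c y u) := by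
  subst hy
  exact mfderiv_comp_apply y (β.mdifferentiableAt_left (c y)) hc u

variable [IsManifold 𝓘(ℝ, EG) 1 G]

/-- Left multiplication by a bisection commutes with right translation, by associativity. This is
the differentiated form. -/
theorem leftDeriv_rightDeriv {g h : G} (hgh : 𝒢.s h = 𝒢.t g) {v : EG}
    (hv : 𝒢.sourceDeriv h v = 0) :
    β.leftDeriv (𝒢.mul h g) (𝒢.rightDeriv g h v) =
      𝒢.rightDeriv g (β.left h) (β.leftDeriv h v) := by
  obtain ⟨c, hc, hch, hs, hcv⟩ := 𝒢.exists_source_retraction h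
  rw [hgh] at hs
  have hc' := hc.mdifferentiableAt (n := ∞) (by simp)
  have h1 := mfderiv_mul_right hch hc' hs v
  have h2 := β.mfderiv_left_comp (c := fun z => 𝒢.mul (c z) g) (g := 𝒢.mul h g) (by simp only [hch])
    ((contMDiffAt_mul_right g hc hs).mdifferentiableAt (by simp)) v
  have h3 := β.mfderiv_left_comp hch hc' v
  have h4 := mfderiv_mul_right (g := g) (c := fun z => β.left (c z)) (h := β.left h)
    (by simp only [hch]) ((β.contMDiff_left.contMDiffAt.comp h hc).mdifferentiableAt (by simp))
    (by filter_upwards [hs] with z hz; rw [β.s_left, hz]) v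
  have h5 : (fun z => β.left (𝒢.mul (c z) g)) =ᶠ[𝓝 h] fun z => 𝒢.mul (β.left (c z)) g := by
    filter_upwards [hs] with z hz
    exact β.left_mul hz
  have h6 := congrArg (𝒢.rightDeriv g h) (hcv v hv)
  have h7 := congrArg (β.leftDeriv h) (hcv v hv)
  exact (congrArg (β.leftDeriv (𝒢.mul h g)) (h6.symm.trans h1.symm)).trans
    (h2.symm.trans ((DFunLike.congr_fun h5.mfderiv_eq v).trans
      (h4.trans (congrArg (𝒢.rightDeriv g (β.left h)) (h3.trans h7)))))

/-- On the source fibre of `Id_m` the factor `β(s g)⁻¹` is the constant arrow `β(m)⁻¹`, so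
conjugation there is left multiplication by `β` followed by one right translation. -/
theorem conjDeriv_eq (m : M) {v : EG} (hv : 𝒢.sourceDeriv (𝒢.one m) v = 0) :
    β.conjDeriv m v =
      𝒢.rightDeriv (𝒢.inv (β.toFun m)) (β.toFun m) (β.leftDeriv (𝒢.one m) v) := by
  obtain ⟨c, hc, hch, hs, hcv⟩ := 𝒢.exists_source_retraction (𝒢.one m)
  rw [𝒢.s_one] at hs
  have hc' := hc.mdifferentiableAt (n := ∞) (by simp)
  have h1 : mfderiv 𝓘(ℝ, EG) 𝓘(ℝ, EG) (fun z => β.conj (c z)) (𝒢.one m) v =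
      mfderiv 𝓘(ℝ, EG) 𝓘(ℝ, EG) β.conj (c (𝒢.one m))
        (mfderiv 𝓘(ℝ, EG) 𝓘(ℝ, EG) c (𝒢.one m) v) :=
    mfderiv_comp_apply _ (β.contMDiff_conj.mdifferentiableAt (by simp)) hc' v
  have h3 := β.mfderiv_left_comp hch hc' v
  have h4 := mfderiv_mul_right (g := 𝒢.inv (β.toFun m)) (c := fun z => β.left (c z))
    (h := β.toFun m) (y := 𝒢.one m)
    (by simp only [hch, left_one])
    ((β.contMDiff_left.contMDiffAt.comp _ hc).mdifferentiableAt (by simp))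
    (by filter_upwards [hs] with z hz; rw [β.s_left, hz, 𝒢.t_inv, β.s_toFun]) v
  have h5 : (fun z => β.conj (c z)) =ᶠ[𝓝 (𝒢.one m)]
      fun z => 𝒢.mul (β.left (c z)) (𝒢.inv (β.toFun m)) := by
    filter_upwards [hs] with z hz
    rw [conj_eq, hz]
  have h7 := congrArg (β.leftDeriv (𝒢.one m)) (hcv v hv)
  rw [hch] at h1
  have h8 := congrArg (mfderiv 𝓘(ℝ, EG) 𝓘(ℝ, EG) β.conj (𝒢.one m)) (hcv v hv)
  exact h8.symm.trans <| h1.symm.trans ((DFunLike.congr_fun h5.mfderiv_eq v).trans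
      (h4.trans (congrArg (𝒢.rightDeriv _ _) (h3.trans h7))))

end Bisection

/-! ### Smooth dependence of right translation on the arrow -/

section Smoothness

variable (𝒢) in
/-- Near a pair `(Id_{t g₀}, g₀)`, the multiplication extends to a smooth map on an open set. -/
theorem exists_mul_extension (g₀ : G) :
    ∃ (F : G × G → G) (W : Set (G × G)), IsOpen W ∧ (𝒢.one (𝒢.t g₀), g₀) ∈ W ∧
      ContMDiffOn (𝓘(ℝ, EG).prod 𝓘(ℝ, EG)) 𝓘(ℝ, EG) ∞ F W ∧
      ∀ q ∈ W, 𝒢.s q.1 = 𝒢.t q.2 → F q = 𝒢.mul q.1 q.2 := by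
  obtain ⟨ρ, U, hU, hxU, hρ, hfρ, hρf⟩ :=
    𝒢.submersion_s.exists_fibre_retraction (𝒢.one (𝒢.t g₀))
  have h1 : ContMDiff (𝓘(ℝ, EG).prod 𝓘(ℝ, EG)) (𝓘(ℝ, EG).prod 𝓘(ℝ, EM)) ∞
      (fun q : G × G => (q.1, 𝒢.t q.2)) :=
    contMDiff_fst.prodMk (𝒢.smooth_t.comp contMDiff_snd)
  -- The first factor is retracted onto the source fibre over `t q.2`, which makes the pair
  -- composable. Pairs that are already composable are left unchanged.
  refine ⟨fun q => 𝒢.mul (ρ (q.1, 𝒢.t q.2)) q.2, (fun q : G × G => (q.1, 𝒢.t q.2)) ⁻¹' U,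
    hU.preimage h1.continuous, ?_, ?_, ?_⟩
  · rw [𝒢.s_one] at hxU
    exact hxU
  · refine 𝒢.smooth_mul.comp (f := fun q : G × G => (ρ (q.1, 𝒢.t q.2), q.2)) ?_ ?_
    · exact (hρ.comp h1.contMDiffOn (fun q hq => hq)).prodMk contMDiff_snd.contMDiffOn
    · intro q hq
      exact hfρ _ hq
  · intro q hq hs
    have h2 : (q.1, 𝒢.s q.1) ∈ U := by rw [hs]; exact hq
    show 𝒢.mul (ρ (q.1, 𝒢.t q.2)) q.2 = _
    rw [← hs, hρf _ h2]

variable [IsManifold 𝓘(ℝ, EG) ∞ G]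

/-- Expresses the derivative within a source fibre through the derivative of a map smooth on an open
set, whose tangent map is known to be smooth. Both agree along germs of maps into the source fibre
of `h`. -/
theorem mfderiv_mul_extension {F : G × G → G} {W : Set (G × G)} (hW : IsOpen W)
    (hF : ContMDiffOn (𝓘(ℝ, EG).prod 𝓘(ℝ, EG)) 𝓘(ℝ, EG) ∞ F W)
    (hFm : ∀ q ∈ W, 𝒢.s q.1 = 𝒢.t q.2 → F q = 𝒢.mul q.1 q.2) {g h : G} (hgh : 𝒢.s h = 𝒢.t g)
    (hq : (h, g) ∈ W) {v : EG} (hv : 𝒢.sourceDeriv h v = 0) :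
    mfderiv (𝓘(ℝ, EG).prod 𝓘(ℝ, EG)) 𝓘(ℝ, EG) F (h, g)
      ((v, 0) : TangentSpace 𝓘(ℝ, EG) h × TangentSpace 𝓘(ℝ, EG) g) = 𝒢.rightDeriv g h v := by
  obtain ⟨c, hc, hch, hs, hcv⟩ := 𝒢.exists_source_retraction h
  rw [hgh] at hs
  have hc' := hc.mdifferentiableAt (n := ∞) (by simp)
  have h1 := mfderiv_mul_right hch hc' hs v
  have hj : MDifferentiableAt 𝓘(ℝ, EG) (𝓘(ℝ, EG).prod 𝓘(ℝ, EG)) (fun k => (c k, g)) h :=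
    hc'.prodMk mdifferentiableAt_const
  have hF' : MDifferentiableAt (𝓘(ℝ, EG).prod 𝓘(ℝ, EG)) 𝓘(ℝ, EG) F (c h, g) := by
    rw [hch]
    exact (hF.contMDiffAt (hW.mem_nhds hq)).mdifferentiableAt (by simp)
  have h2 : mfderiv 𝓘(ℝ, EG) 𝓘(ℝ, EG) (fun k => F (c k, g)) h v =
      mfderiv (𝓘(ℝ, EG).prod 𝓘(ℝ, EG)) 𝓘(ℝ, EG) F (c h, g)
        ((v, 0) : TangentSpace 𝓘(ℝ, EG) h × TangentSpace 𝓘(ℝ, EG) g) :=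
    (mfderiv_comp_apply h hF' hj v).trans
      (congrArg _ ((DFunLike.congr_fun (mfderiv_prodMk hc' mdifferentiableAt_const) v).trans
        (Prod.ext (hcv v hv) (DFunLike.congr_fun (mfderiv_const (x := h) (c := g)) v))))
  have h3 : (fun k => F (c k, g)) =ᶠ[𝓝 h] fun k => 𝒢.mul (c k) g := by
    have : ∀ᶠ k in 𝓝 h, (c k, g) ∈ W :=
      hj.continuousAt.preimage_mem_nhds (hW.mem_nhds (by rwa [hch]))
    filter_upwards [hs, this] with k hk hk'
    exact hFm _ hk' hk
  rw [hch] at h2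
  exact h2.symm.trans ((DFunLike.congr_fun h3.mfderiv_eq v).trans
    (h1.trans (congrArg (𝒢.rightDeriv g h) (hcv v hv))))

/-- Right translation of a smooth family of elements of the Lie algebroid by a smooth family of
arrows is smooth. -/
theorem contMDiffOn_rightDeriv {S : Set N} {g : N → G} {a : N → EG}
    (hg : ContMDiffOn K 𝓘(ℝ, EG) ∞ g S)
    (ha : ContMDiffOn K 𝓘(ℝ, EG).tangent ∞
      (fun z => (⟨𝒢.one (𝒢.t (g z)), a z⟩ : TangentBundle 𝓘(ℝ, EG) G)) S)
    (has : ∀ z ∈ S, 𝒢.sourceDeriv (𝒢.one (𝒢.t (g z))) (a z) = 0) :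
    ContMDiffOn K 𝓘(ℝ, EG).tangent ∞
      (fun z => (⟨g z, 𝒢.rightDeriv (g z) (𝒢.one (𝒢.t (g z))) (a z)⟩ :
        TangentBundle 𝓘(ℝ, EG) G)) S := by
  intro z hz
  obtain ⟨F, W, hW, hzW, hF, hFm⟩ := 𝒢.exists_mul_extension (g z)
  -- The wanted map is `TF` applied to the smooth family of vectors `(a z, 0)` at `(Id_{t (g z)}, g
  -- z)`, because `F (Id_{t g}, g) = g`.
  have h1 := ha.tangentProdMk hg.tangentZero
  have h2 := (hW.contMDiffOn_tangentMap hF).contMDiffAt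
    (x := (⟨(𝒢.one (𝒢.t (g z)), g z), (a z, 0)⟩ :
      TangentBundle (𝓘(ℝ, EG).prod 𝓘(ℝ, EG)) (G × G)))
    ((hW.preimage (FiberBundle.continuous_proj _ _)).mem_nhds hzW)
  have h3 := h2.comp_contMDiffWithinAt z (h1 z hz)
  refine h3.congr_of_eventuallyEq_of_mem ?_ hz
  have h4 : ∀ᶠ y in 𝓝[S] z, (𝒢.one (𝒢.t (g y)), g y) ∈ W :=
    ((((𝒢.smooth_one.comp 𝒢.smooth_t).comp_contMDiffOn hg).prodMk hg).continuousOn z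
      hz).preimage_mem_nhdsWithin (hW.mem_nhds hzW)
  filter_upwards [h4, self_mem_nhdsWithin] with y hy hyS
  refine TangentBundle.mk_eq_mk ?_ (mfderiv_mul_extension hW hF hFm (𝒢.s_one _) hy (has y hyS)).symm
  rw [hFm _ hy (𝒢.s_one _), 𝒢.one_mul]

end Smoothness

end LieGroupoid

/-! ### Derivatives of local trivialisations and of the action -/

namespace FibredModule

variable {EM EG M G EB EP B P : Type*}
  [NormedAddCommGroup EM] [NormedSpace ℝ EM] [NormedAddCommGroup EG] [NormedSpace ℝ EG]
  [TopologicalSpace M] [ChartedSpace EM M] [TopologicalSpace G] [ChartedSpace EG G]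
  [NormedAddCommGroup EB] [NormedSpace ℝ EB] [NormedAddCommGroup EP] [NormedSpace ℝ EP]
  [TopologicalSpace B] [ChartedSpace EB B] [TopologicalSpace P] [ChartedSpace EP P]
  {𝒢 : LieGroupoid EM EG M G} {X : FibredModule 𝒢 EB EP B P}

namespace LocalTrivialisation

variable (τ τ' : X.LocalTrivialisation)

/-- The inverse of a local trivialisation at a pair of points. -/
def inv (σ : B) (g : G) : P := τ.toOpenPartialHomeomorph.symm (σ, g)

/-- The derivative of a local trivialisation, as a linear map between model spaces. -/
def deriv (p : P) : EP →L[ℝ] EB × EG :=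
  mfderiv 𝓘(ℝ, EP) (𝓘(ℝ, EB).prod 𝓘(ℝ, EG)) τ.toOpenPartialHomeomorph p

/-- The derivative of the inverse of a local trivialisation, as a linear map between model
spaces. -/
def invDeriv (σ : B) (g : G) : EB × EG →L[ℝ] EP :=
  mfderiv (𝓘(ℝ, EB).prod 𝓘(ℝ, EG)) 𝓘(ℝ, EP) τ.toOpenPartialHomeomorph.symm (σ, g)

variable {τ τ'} {σ : B} {p : P}

theorem mem_target (hσ : σ ∈ τ.baseSet) (g : G) : (σ, g) ∈ τ.target := by
  rw [τ.target_eq]; exact ⟨hσ, mem_univ _⟩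

theorem inv_mem_source (hσ : σ ∈ τ.baseSet) (g : G) : τ.inv σ g ∈ τ.source :=
  symm_mem_source τ τ hσ hσ g

theorem apply_inv (hσ : σ ∈ τ.baseSet) (g : G) :
    τ.toOpenPartialHomeomorph (τ.inv σ g) = (σ, g) := apply_symm_self τ hσ g

theorem proj_inv (hσ : σ ∈ τ.baseSet) (g : G) : X.proj (τ.inv σ g) = σ :=
  τ.toTrivialization.proj_symm_apply' hσ

theorem proj_mem_baseSet (hp : p ∈ τ.source) : X.proj p ∈ τ.baseSet := by
  rw [τ.source_eq] at hp; exact hp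

theorem fst_apply (hp : p ∈ τ.source) : (τ.toOpenPartialHomeomorph p).1 = X.proj p :=
  τ.proj_toFun p hp

theorem inv_apply (hp : p ∈ τ.source) :
    τ.inv (X.proj p) (τ.toOpenPartialHomeomorph p).2 = p := by
  rw [← fst_apply hp]
  exact τ.toOpenPartialHomeomorph.left_inv hp

theorem μ_eq (hp : p ∈ τ.source) : X.μ p = 𝒢.s (τ.toOpenPartialHomeomorph p).2 := by
  rw [← τ.μ_symm _ (proj_mem_baseSet hp)]
  exact congrArg X.μ (inv_apply hp).symm

theorem source_mem_nhds (hp : p ∈ τ.source) : τ.source ∈ 𝓝 p := τ.open_source.mem_nhds hp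

theorem target_mem_nhds (hσ : σ ∈ τ.baseSet) (g : G) : τ.target ∈ 𝓝 (σ, g) :=
  τ.open_target.mem_nhds (mem_target hσ g)

theorem mdifferentiableAt (hp : p ∈ τ.source) :
    MDifferentiableAt 𝓘(ℝ, EP) (𝓘(ℝ, EB).prod 𝓘(ℝ, EG)) τ.toOpenPartialHomeomorph p :=
  (τ.smooth_toFun.contMDiffAt (source_mem_nhds hp)).mdifferentiableAt (by simp)

theorem mdifferentiableAt_symm (hσ : σ ∈ τ.baseSet) (g : G) :
    MDifferentiableAt (𝓘(ℝ, EB).prod 𝓘(ℝ, EG)) 𝓘(ℝ, EP) τ.toOpenPartialHomeomorph.symm (σ, g) :=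
  (τ.smooth_symm.contMDiffAt (target_mem_nhds hσ g)).mdifferentiableAt (by simp)

theorem deriv_invDeriv (hσ : σ ∈ τ.baseSet) (g : G) (w : EB × EG) :
    τ.deriv (τ.inv σ g) (τ.invDeriv σ g w) = w := by
  have h1 := mfderiv_comp_apply (σ, g) (mdifferentiableAt (inv_mem_source hσ g))
    (mdifferentiableAt_symm hσ g) w
  have h2 : τ.toOpenPartialHomeomorph ∘ τ.toOpenPartialHomeomorph.symm =ᶠ[𝓝 (σ, g)] id := by
    filter_upwards [target_mem_nhds hσ g] with q hq
    exact τ.toOpenPartialHomeomorph.right_inv hq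
  exact h1.symm.trans ((DFunLike.congr_fun h2.mfderiv_eq w).trans
    (DFunLike.congr_fun mfderiv_id w))

theorem invDeriv_deriv (hσ : σ ∈ τ.baseSet) (g : G) (w : EP) :
    τ.invDeriv σ g (τ.deriv (τ.inv σ g) w) = w := by
  have h0 := mdifferentiableAt_symm hσ g
  rw [← apply_inv hσ g] at h0
  have h1 := mfderiv_comp_apply (τ.inv σ g) h0 (mdifferentiableAt (inv_mem_source hσ g)) w
  have h2 : τ.toOpenPartialHomeomorph.symm ∘ τ.toOpenPartialHomeomorph =ᶠ[𝓝 (τ.inv σ g)] id := by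
    filter_upwards [source_mem_nhds (inv_mem_source hσ g)] with q hq
    exact τ.toOpenPartialHomeomorph.left_inv hq
  rw [apply_inv hσ g] at h1
  exact h1.symm.trans ((DFunLike.congr_fun h2.mfderiv_eq w).trans
    (DFunLike.congr_fun mfderiv_id w))

theorem fst_deriv (hp : p ∈ τ.source) (w : EP) :
    (τ.deriv p w).1 = mfderiv 𝓘(ℝ, EP) 𝓘(ℝ, EB) X.proj p w := by
  have h1 := mfderiv_comp_apply p (mdifferentiableAt_fst (I := 𝓘(ℝ, EB)) (I' := 𝓘(ℝ, EG))
    (x := τ.toOpenPartialHomeomorph p)) (mdifferentiableAt hp) w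
  have h2 : Prod.fst ∘ τ.toOpenPartialHomeomorph =ᶠ[𝓝 p] X.proj := by
    filter_upwards [source_mem_nhds hp] with q hq
    exact fst_apply hq
  rw [mfderiv_fst] at h1
  exact h1.symm.trans (DFunLike.congr_fun h2.mfderiv_eq w)

theorem mfderiv_proj_invDeriv (hσ : σ ∈ τ.baseSet) (g : G) (w : EB × EG) :
    mfderiv 𝓘(ℝ, EP) 𝓘(ℝ, EB) X.proj (τ.inv σ g) (τ.invDeriv σ g w) = w.1 :=
  (fst_deriv (inv_mem_source hσ g) _).symm.trans (congrArg Prod.fst (deriv_invDeriv hσ g w))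

theorem sourceDeriv_snd_deriv (hp : p ∈ τ.source) (w : EP) :
    𝒢.sourceDeriv (τ.toOpenPartialHomeomorph p).2 (τ.deriv p w).2 =
      mfderiv 𝓘(ℝ, EP) 𝓘(ℝ, EM) X.μ p w := by
  have h1 := mfderiv_comp_apply p (mdifferentiableAt_snd (I := 𝓘(ℝ, EB)) (I' := 𝓘(ℝ, EG))
    (x := τ.toOpenPartialHomeomorph p)) (mdifferentiableAt hp) w
  rw [mfderiv_snd] at h1
  refine (congrArg (𝒢.sourceDeriv _) h1.symm).trans ?_
  refine LieGroupoid.sourceDeriv_mfderiv_of_comp_eq rfl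
    (mdifferentiableAt_snd.comp p (mdifferentiableAt hp)) ?_ w
  filter_upwards [source_mem_nhds hp] with q hq
  exact (μ_eq hq).symm

theorem mfderiv_μ_invDeriv (hσ : σ ∈ τ.baseSet) (g : G) (w : EB × EG) :
    mfderiv 𝓘(ℝ, EP) 𝓘(ℝ, EM) X.μ (τ.inv σ g) (τ.invDeriv σ g w) = 𝒢.sourceDeriv g w.2 := by
  have h1 := sourceDeriv_snd_deriv (inv_mem_source hσ g) (τ.invDeriv σ g w)
  rw [apply_inv hσ, deriv_invDeriv hσ] at h1
  exact h1.symm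

theorem mdifferentiableWithinAt_act (h : G) (hp : X.μ p = 𝒢.t h) :
    MDifferentiableWithinAt 𝓘(ℝ, EP) 𝓘(ℝ, EP) (fun q => X.act q h) {q | X.μ q = 𝒢.t h} p := by
  have h1 : ContMDiffOn 𝓘(ℝ, EP) 𝓘(ℝ, EP) ∞ (fun q => X.act q h) {q | X.μ q = 𝒢.t h} :=
    X.smooth_act.comp (f := fun q : P => (q, h)) (contMDiff_id.prodMk contMDiff_const).contMDiffOn
      (fun q hq => hq)
  exact (h1 p hp).mdifferentiableWithinAt (by simp)

/-- The trivialisation turns the action of `h` into `(σ, g) ↦ (σ, g.h)`. As `V` lies in `ker T s`,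
the vector `(v, V)` is the image of itself under the derivative of `id × c`, with `c` a retraction
onto the source fibre of `g`, and along this map the action is defined. -/
theorem mfderivWithin_act [IsManifold 𝓘(ℝ, EG) 1 G] (hσ : σ ∈ τ.baseSet) {g h : G}
    (hgh : 𝒢.s g = 𝒢.t h) {v : EB} {V : EG} (hV : 𝒢.sourceDeriv g V = 0) :
    mfderivWithin 𝓘(ℝ, EP) 𝓘(ℝ, EP) (fun q => X.act q h) {q | X.μ q = 𝒢.t h} (τ.inv σ g)
      (τ.invDeriv σ g (v, V)) = τ.invDeriv σ (𝒢.mul g h) (v, 𝒢.rightDeriv h g V) := by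
  obtain ⟨c, hc, hcg, hs, hcv⟩ := 𝒢.exists_source_retraction g
  rw [hgh] at hs
  have hc' := hc.mdifferentiableAt (n := ∞) (by simp)
  have hm := (LieGroupoid.contMDiffAt_mul_right h hc hs).mdifferentiableAt (n := ∞) (by simp)
  have hj : MDifferentiableAt (𝓘(ℝ, EB).prod 𝓘(ℝ, EG)) (𝓘(ℝ, EB).prod 𝓘(ℝ, EG))
      (Prod.map (id : B → B) c) (σ, g) := mdifferentiableAt_id.prodMap hc'
  have hk : MDifferentiableAt (𝓘(ℝ, EB).prod 𝓘(ℝ, EG)) (𝓘(ℝ, EB).prod 𝓘(ℝ, EG))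
      (Prod.map (id : B → B) (fun k => 𝒢.mul (c k) h)) (σ, g) := mdifferentiableAt_id.prodMap hm
  have e1 : mfderiv (𝓘(ℝ, EB).prod 𝓘(ℝ, EG)) (𝓘(ℝ, EB).prod 𝓘(ℝ, EG))
      (Prod.map (id : B → B) c) (σ, g) (v, V) = (v, V) :=
    (DFunLike.congr_fun (mfderiv_prodMap mdifferentiableAt_id hc') (v, V)).trans
      (Prod.ext (DFunLike.congr_fun mfderiv_id v) (hcv V hV))
  have e2 : mfderiv (𝓘(ℝ, EB).prod 𝓘(ℝ, EG)) (𝓘(ℝ, EB).prod 𝓘(ℝ, EG))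
      (Prod.map (id : B → B) (fun k => 𝒢.mul (c k) h)) (σ, g) (v, V) =
        (v, 𝒢.rightDeriv h g V) :=
    (DFunLike.congr_fun (mfderiv_prodMap mdifferentiableAt_id hm) (v, V)).trans
      (Prod.ext (DFunLike.congr_fun mfderiv_id v)
        ((LieGroupoid.mfderiv_mul_right hcg hc' hs V).trans (congrArg _ (hcv V hV))))
  have ej : Prod.map (id : B → B) c (σ, g) = (σ, g) := Prod.ext rfl hcg
  have ek : Prod.map (id : B → B) (fun k => 𝒢.mul (c k) h) (σ, g) = (σ, 𝒢.mul g h) :=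
    Prod.ext rfl (by simp only [Prod.map, hcg])
  have d1 : MDifferentiableAt (𝓘(ℝ, EB).prod 𝓘(ℝ, EG)) 𝓘(ℝ, EP) τ.toOpenPartialHomeomorph.symm
      (Prod.map (id : B → B) c (σ, g)) := by rw [ej]; exact mdifferentiableAt_symm hσ g
  have d2 : MDifferentiableAt (𝓘(ℝ, EB).prod 𝓘(ℝ, EG)) 𝓘(ℝ, EP) τ.toOpenPartialHomeomorph.symm
      (Prod.map (id : B → B) (fun k => 𝒢.mul (c k) h) (σ, g)) := by
    rw [ek]; exact mdifferentiableAt_symm hσ _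
  have hq : ∀ᶠ q : B × G in 𝓝 (σ, g), q.1 ∈ τ.baseSet ∧ 𝒢.s (c q.2) = 𝒢.t h := by
    have := (τ.open_baseSet.mem_nhds hσ)
    rw [nhds_prod_eq]
    exact (Filter.eventually_of_mem this fun _ hx => hx).prod_mk hs
  -- The composite stays in the fibre `μ⁻¹(t h)`, so the derivative within this fibre is determined
  -- on its velocities.
  have hmem : ∀ᶠ q in 𝓝 (σ, g),
      (τ.toOpenPartialHomeomorph.symm ∘ Prod.map (id : B → B) c) q ∈ {q | X.μ q = 𝒢.t h} := by
    filter_upwards [hq] with q hq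
    exact (τ.μ_symm q.1 hq.1 (c q.2)).trans hq.2
  have hact : (fun q => X.act ((τ.toOpenPartialHomeomorph.symm ∘ Prod.map (id : B → B) c) q) h)
      =ᶠ[𝓝 (σ, g)] τ.toOpenPartialHomeomorph.symm ∘
        Prod.map (id : B → B) (fun k => 𝒢.mul (c k) h) := by
    filter_upwards [hq] with q hq
    exact τ.act_symm q.1 hq.1 (c q.2) h hq.2
  have c1 := mfderiv_comp_of_eventually_mem
    (mdifferentiableWithinAt_act h hmem.self_of_nhds) (d1.comp (σ, g) hj) hmem (v, V)
  have c2 := mfderiv_comp_apply (σ, g) d1 hj (v, V)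
  have c3 := mfderiv_comp_apply (σ, g) d2 hk (v, V)
  have c4 := DFunLike.congr_fun (hact.mfderiv_eq (I := 𝓘(ℝ, EB).prod 𝓘(ℝ, EG)) (I' := 𝓘(ℝ, EP)))
    (v, V)
  have c5 : (τ.toOpenPartialHomeomorph.symm ∘ Prod.map (id : B → B) c) (σ, g) = τ.inv σ g :=
    congrArg τ.toOpenPartialHomeomorph.symm ej
  rw [c5] at c1
  rw [ej] at c2
  rw [ek] at c3
  have c2' := c2.trans (congrArg (τ.invDeriv σ g) e1)
  have c3' := c3.trans (congrArg (τ.invDeriv σ (𝒢.mul g h)) e2)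
  have c6 := congrArg (mfderivWithin 𝓘(ℝ, EP) 𝓘(ℝ, EP) (fun q => X.act q h)
    {q | X.μ q = 𝒢.t h} (τ.inv σ g)) c2'
  exact c6.symm.trans (c1.symm.trans (c4.trans c3'))

end LocalTrivialisation

end FibredModule

/-! ### The derivative of a transition map -/

namespace FibredModule

variable {EM EG M G EB EP B P : Type*}
  [NormedAddCommGroup EM] [NormedSpace ℝ EM] [NormedAddCommGroup EG] [NormedSpace ℝ EG]
  [TopologicalSpace M] [ChartedSpace EM M] [TopologicalSpace G] [ChartedSpace EG G]
  [NormedAddCommGroup EB] [NormedSpace ℝ EB] [NormedAddCommGroup EP] [NormedSpace ℝ EP]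
  [TopologicalSpace B] [ChartedSpace EB B] [TopologicalSpace P] [ChartedSpace EP P]
  {𝒢 : LieGroupoid EM EG M G} {X : FibredModule 𝒢 EB EP B P}

namespace LocalTrivialisation

variable {τ τ' : X.LocalTrivialisation} {σ : B} {p : P}

variable (τ τ') in
/-- The derivative `T_σ (ev_m ∘ β_{τ τ'})`, as a linear map between model spaces. -/
def transitionDeriv (σ : B) (m : M) : EB →L[ℝ] EG :=
  mfderiv 𝓘(ℝ, EB) 𝓘(ℝ, EG) (fun σ' => transitionArrow τ τ' σ' m) σ

theorem sourceDeriv_transitionDeriv (hσ : σ ∈ τ.baseSet) (hσ' : σ ∈ τ'.baseSet) (m : M) (v : EB) :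
    𝒢.sourceDeriv (transitionArrow τ τ' σ m) (transitionDeriv τ τ' σ m v) = 0 :=
  tangentTransition_mem τ τ' σ hσ hσ' m v

theorem contMDiffAt_transitionArrow (hσ : σ ∈ τ.baseSet) (hσ' : σ ∈ τ'.baseSet) (m : M) :
    ContMDiffAt 𝓘(ℝ, EB) 𝓘(ℝ, EG) ∞ (fun σ' => transitionArrow τ τ' σ' m) σ := by
  have h1 : ContMDiffOn 𝓘(ℝ, EB) 𝓘(ℝ, EG) ∞ (fun σ' => transitionArrow τ τ' σ' m)
      (τ.baseSet ∩ τ'.baseSet) :=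
    (τ.smooth_transition τ').comp
      (g := fun q : B × M => transitionArrow τ τ' q.1 q.2) (f := fun σ' : B => (σ', m))
      (contMDiff_id.prodMk contMDiff_const).contMDiffOn (fun σ' hσ => ⟨hσ, mem_univ _⟩)
  exact h1.contMDiffAt ((τ.open_baseSet.inter τ'.open_baseSet).mem_nhds ⟨hσ, hσ'⟩)

theorem inv_transition (hσ : σ ∈ τ.baseSet) (hσ' : σ ∈ τ'.baseSet) (g : G) :
    τ.inv σ ((transition τ τ' σ hσ hσ').left g) = τ'.inv σ g := by
  have h1 := symm_apply_symm τ τ' hσ hσ' g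
  rw [apply_symm τ τ' hσ hσ' g] at h1
  exact h1

/-- The transition map is `(σ, g) ↦ (σ, β(σ)(t g).g)`. With `g` fixed it is right translation by `g`
of the family `β(·)(t g)`; with `σ` fixed it is left multiplication by a bisection. Linearity adds
the two contributions. -/
theorem deriv_invDeriv_transition (hσ : σ ∈ τ.baseSet) (hσ' : σ ∈ τ'.baseSet) (g : G)
    (v : EB) (V : EG) :
    τ.deriv (τ'.inv σ g) (τ'.invDeriv σ g (v, V)) =
      (v, 𝒢.rightDeriv g (transitionArrow τ τ' σ (𝒢.t g)) (transitionDeriv τ τ' σ (𝒢.t g) v) +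
        (transition τ τ' σ hσ hσ').leftDeriv g V) := by
  set T : B × G → B × G := τ.toOpenPartialHomeomorph ∘ τ'.toOpenPartialHomeomorph.symm with hT
  have hd : MDifferentiableAt 𝓘(ℝ, EP) (𝓘(ℝ, EB).prod 𝓘(ℝ, EG)) τ.toOpenPartialHomeomorph
      (τ'.toOpenPartialHomeomorph.symm (σ, g)) := mdifferentiableAt (symm_mem_source τ τ' hσ hσ' g)
  have hd' := mdifferentiableAt_symm hσ' g
  have hTd : MDifferentiableAt (𝓘(ℝ, EB).prod 𝓘(ℝ, EG)) (𝓘(ℝ, EB).prod 𝓘(ℝ, EG)) T (σ, g) :=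
    hd.comp (σ, g) hd'
  have hTv : ∀ w : EB × EG, τ.deriv (τ'.inv σ g) (τ'.invDeriv σ g w) =
      (mfderiv (𝓘(ℝ, EB).prod 𝓘(ℝ, EG)) (𝓘(ℝ, EB).prod 𝓘(ℝ, EG)) T (σ, g) w : EB × EG) :=
    fun w => (mfderiv_comp_apply (σ, g) hd hd' w).symm
  have hO : ∀ᶠ σ' in 𝓝 σ, σ' ∈ τ.baseSet ∩ τ'.baseSet :=
    (τ.open_baseSet.inter τ'.open_baseSet).mem_nhds ⟨hσ, hσ'⟩
  have hs : ∀ᶠ σ' in 𝓝 σ, 𝒢.s (transitionArrow τ τ' σ' (𝒢.t g)) = 𝒢.t g := by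
    filter_upwards [hO] with σ' h
    exact s_transitionArrow τ τ' h.1 h.2 _
  have h1 : τ.deriv (τ'.inv σ g) (τ'.invDeriv σ g (v, 0)) =
      (v, 𝒢.rightDeriv g (transitionArrow τ τ' σ (𝒢.t g))
        (transitionDeriv τ τ' σ (𝒢.t g) v)) := by
    have hb' := contMDiffAt_transitionArrow hσ hσ' (𝒢.t g)
    have hb := hb'.mdifferentiableAt (n := ∞) (by simp)
    have hm := (LieGroupoid.contMDiffAt_mul_right g hb' hs).mdifferentiableAt (n := ∞) (by simp)
    have hi : MDifferentiableAt 𝓘(ℝ, EB) (𝓘(ℝ, EB).prod 𝓘(ℝ, EG)) (fun σ' => (σ', g)) σ :=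
      mdifferentiableAt_id.prodMk mdifferentiableAt_const
    have e1 := mfderiv_comp_apply σ hTd hi v
    have e2 : T ∘ (fun σ' => (σ', g)) =ᶠ[𝓝 σ]
        fun σ' => (σ', 𝒢.mul (transitionArrow τ τ' σ' (𝒢.t g)) g) := by
      filter_upwards [hO] with σ' h
      exact apply_symm τ τ' h.1 h.2 g
    have e3 := DFunLike.congr_fun (e2.mfderiv_eq (I := 𝓘(ℝ, EB)) (I' := 𝓘(ℝ, EB).prod 𝓘(ℝ, EG))) v
    have e4 := DFunLike.congr_fun (mfderiv_prodMk mdifferentiableAt_id hm) v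
    have e5 := LieGroupoid.mfderiv_mul_right rfl hb hs v
    have e6 := congrArg (mfderiv (𝓘(ℝ, EB).prod 𝓘(ℝ, EG)) (𝓘(ℝ, EB).prod 𝓘(ℝ, EG)) T (σ, g))
      (DFunLike.congr_fun (mfderiv_prod_left (I := 𝓘(ℝ, EB)) (I' := 𝓘(ℝ, EG)) (x₀ := σ)
        (y₀ := g)) v)
    refine (hTv _).trans (e6.symm.trans (e1.symm.trans (e3.trans (e4.trans ?_))))
    exact Prod.ext (DFunLike.congr_fun mfderiv_id v) e5
  have h2 : τ.deriv (τ'.inv σ g) (τ'.invDeriv σ g (0, V)) =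
      (0, (transition τ τ' σ hσ hσ').leftDeriv g V) := by
    have hi : MDifferentiableAt 𝓘(ℝ, EG) (𝓘(ℝ, EB).prod 𝓘(ℝ, EG)) (fun g' => (σ, g')) g :=
      mdifferentiableAt_const.prodMk mdifferentiableAt_id
    have e1 := mfderiv_comp_apply g hTd hi V
    have e2 : T ∘ (fun g' => (σ, g')) = fun g' => (σ, (transition τ τ' σ hσ hσ').left g') := by
      funext g'
      exact apply_symm τ τ' hσ hσ' g'
    rw [e2] at e1
    have e4 := DFunLike.congr_fun (mfderiv_prodMk (I := 𝓘(ℝ, EG)) (I' := 𝓘(ℝ, EB))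
      (I'' := 𝓘(ℝ, EG)) (f := fun _ : G => σ) mdifferentiableAt_const
      ((transition τ τ' σ hσ hσ').mdifferentiableAt_left g)) V
    have e6 := congrArg (mfderiv (𝓘(ℝ, EB).prod 𝓘(ℝ, EG)) (𝓘(ℝ, EB).prod 𝓘(ℝ, EG)) T (σ, g))
      (DFunLike.congr_fun (mfderiv_prod_right (I := 𝓘(ℝ, EB)) (I' := 𝓘(ℝ, EG)) (x₀ := σ)
        (y₀ := g)) V)
    refine (hTv _).trans (e6.symm.trans (e1.symm.trans (e4.trans ?_)))
    exact Prod.ext (DFunLike.congr_fun (mfderiv_const (x := g) (c := σ)) V) rfl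
  have h3 : ((v, V) : EB × EG) = (v, 0) + (0, V) := by simp
  rw [h3, map_add, map_add, h1, h2]
  simp

end LocalTrivialisation

end FibredModule

/-! ### The gluing law without inverses, and its propagation to all arrows -/

namespace LieGroupoid.Bisection

variable {EM EG M G : Type*}
  [NormedAddCommGroup EM] [NormedSpace ℝ EM] [NormedAddCommGroup EG] [NormedSpace ℝ EG]
  [TopologicalSpace M] [ChartedSpace EM M] [TopologicalSpace G] [ChartedSpace EG G]
  [IsManifold 𝓘(ℝ, EG) 1 G] {𝒢 : LieGroupoid EM EG M G} (β : 𝒢.Bisection) (m : M) {a a' b : EG}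

/-- The gluing law of local connection data, expressed without inverses. -/
theorem gluing_iff (ha : 𝒢.sourceDeriv (𝒢.one (β.shadow m)) a = 0)
    (ha' : 𝒢.sourceDeriv (𝒢.one m) a' = 0) (hb : 𝒢.sourceDeriv (β.toFun m) b = 0) :
    a = β.conjDeriv m a' - 𝒢.rightDeriv (𝒢.inv (β.toFun m)) (β.toFun m) b ↔
      b + 𝒢.rightDeriv (β.toFun m) (𝒢.one (β.shadow m)) a = β.leftDeriv (𝒢.one m) a' := by
  have h1 : 𝒢.mul (𝒢.one (β.shadow m)) (β.toFun m) = β.toFun m := 𝒢.one_mul _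
  have h2 : 𝒢.mul (β.toFun m) (𝒢.inv (β.toFun m)) = 𝒢.one (β.shadow m) := 𝒢.mul_inv _
  have h3 := rightDeriv_inv_rightDeriv (𝒢.s_one (β.shadow m)) ha
  rw [show 𝒢.mul (𝒢.one (β.shadow m)) (β.toFun m) = β.toFun m from h1] at h3
  have h4 : 𝒢.sourceDeriv (β.toFun m) (β.leftDeriv (𝒢.one m) a' - b) = 0 := by
    have := β.sourceDeriv_leftDeriv (𝒢.one m) a'
    rw [β.left_one, ha'] at this
    rw [map_sub, this, hb, sub_zero]
  have h5 := rightDeriv_rightDeriv_inv (g := β.toFun m) rfl h4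
  rw [h2] at h5
  -- The conjugation and Maurer–Cartan terms are both right translations by `β(m)⁻¹`, so they merge
  -- into the right translation of the single vector `β.leftDeriv (Id_m) a' - b`, which `h4` places
  -- in `ker T s`.
  rw [β.conjDeriv_eq m ha', ← map_sub]
  constructor
  · intro h
    rw [h, h5]; abel
  · intro h
    rw [← h, add_sub_cancel_left]
    exact h3.symm

/-- The inverse-free form of the gluing law propagates from the units by right translation. -/
theorem gluing_right (g : G) (ha : 𝒢.sourceDeriv (𝒢.one (β.shadow (𝒢.t g))) a = 0)
    (ha' : 𝒢.sourceDeriv (𝒢.one (𝒢.t g)) a' = 0)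
    (h : b + 𝒢.rightDeriv (β.toFun (𝒢.t g)) (𝒢.one (β.shadow (𝒢.t g))) a =
      β.leftDeriv (𝒢.one (𝒢.t g)) a') :
    𝒢.rightDeriv g (β.toFun (𝒢.t g)) b +
        𝒢.rightDeriv (β.left g) (𝒢.one (β.shadow (𝒢.t g))) a =
      β.leftDeriv g (𝒢.rightDeriv g (𝒢.one (𝒢.t g)) a') := by
  have h1 := rightDeriv_rightDeriv (𝒢.s_one (β.shadow (𝒢.t g))) (β.s_toFun (𝒢.t g)) ha
  have h2 : 𝒢.mul (𝒢.one (β.shadow (𝒢.t g))) (β.toFun (𝒢.t g)) = β.toFun (𝒢.t g) := 𝒢.one_mul _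
  have h3 := β.leftDeriv_rightDeriv (𝒢.s_one (𝒢.t g)) ha'
  rw [𝒢.one_mul, β.left_one, ← h, map_add] at h3
  rw [h3]
  congr 1
  rw [show 𝒢.mul (𝒢.one (β.shadow (𝒢.t g))) (β.toFun (𝒢.t g)) = β.toFun (𝒢.t g) from h2] at h1
  exact h1.symm

end LieGroupoid.Bisection

/-! ### From connection forms to local data -/

namespace FibredModule

variable {EM EG M G EB EP B P : Type*}
  [NormedAddCommGroup EM] [NormedSpace ℝ EM] [NormedAddCommGroup EG] [NormedSpace ℝ EG]
  [TopologicalSpace M] [ChartedSpace EM M] [TopologicalSpace G] [ChartedSpace EG G]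
  [NormedAddCommGroup EB] [NormedSpace ℝ EB] [NormedAddCommGroup EP] [NormedSpace ℝ EP]
  [TopologicalSpace B] [ChartedSpace EB B] [TopologicalSpace P] [ChartedSpace EP P]
  {𝒢 : LieGroupoid EM EG M G} {X : FibredModule 𝒢 EB EP B P}

open LocalTrivialisation

namespace LocalConnectionData

variable [IsManifold 𝓘(ℝ, EB) ∞ B] [IsManifold 𝓘(ℝ, EG) ∞ G] {ι : Type*}
  {τs : ι → X.LocalTrivialisation} (A : X.LocalConnectionData τs)

open Classical in
/-- The value of local connection data at a pair of points, as a linear map between model spaces,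
extended by zero. -/
def toMap (i : ι) (σ : B) (m : M) : EB →L[ℝ] EG :=
  if h : σ ∈ (τs i).baseSet then (𝒢.algebroidFibre m).subtypeL.comp (A.form i σ h m) else 0

theorem coe_form {i : ι} {σ : B} (hσ : σ ∈ (τs i).baseSet) (m : M) (v : EB) :
    (A.form i σ hσ m v).1 = A.toMap i σ m v :=
  (DFunLike.congr_fun (dif_pos hσ : A.toMap i σ m = _) v).symm

theorem sourceDeriv_toMap {i : ι} {σ : B} (hσ : σ ∈ (τs i).baseSet) (m : M) (v : EB) :
    𝒢.sourceDeriv (𝒢.one m) (A.toMap i σ m v) = 0 := by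
  rw [← A.coe_form hσ m v]
  exact (A.form i σ hσ m v).2

/-- The horizontal part in the `i`-th local trivialisation of the connection form determined by
local connection data. -/
def localForm (i : ι) (σ : B) (g : G) : EB →L[ℝ] EG :=
  (𝒢.rightDeriv g (𝒢.one (𝒢.t g))).comp (A.toMap i σ (𝒢.t g))

end LocalConnectionData

namespace ConnectionForm

variable [IsManifold 𝓘(ℝ, EP) ∞ P] (Θ : X.ConnectionForm) {τ τ' : X.LocalTrivialisation} {σ : B}

/-- The value of a connection form at a point, as a linear map between model spaces. -/
def toMap (p : P) : EP →L[ℝ] EP := (X.vertical p).subtypeL.comp (Θ.form p)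

variable (τ) in
/-- The horizontal part `v ↦ pr₂ ((τ⁻¹)^* Θ (v, 0))` of a connection form in a local
trivialisation. -/
def localForm (σ : B) (g : G) : EB →L[ℝ] EG :=
  (ContinuousLinearMap.snd ℝ EB EG).comp ((τ.deriv (τ.inv σ g)).comp
    ((Θ.toMap (τ.inv σ g)).comp ((τ.invDeriv σ g).comp (ContinuousLinearMap.inl ℝ EB EG))))

theorem localForm_apply (g : G) (v : EB) : Θ.localForm τ σ g v =
    (τ.deriv (τ.inv σ g) (Θ.toMap (τ.inv σ g) (τ.invDeriv σ g (v, 0)))).2 := rfl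

theorem mfderiv_proj_toMap (p : P) (w : EP) :
    mfderiv 𝓘(ℝ, EP) 𝓘(ℝ, EB) X.proj p (Θ.toMap p w) = 0 := (Θ.form p w).2

theorem toMap_of_vertical {p : P} {w : EP} (hw : mfderiv 𝓘(ℝ, EP) 𝓘(ℝ, EB) X.proj p w = 0) :
    Θ.toMap p w = w := congrArg Subtype.val (Θ.form_vertical p ⟨w, hw⟩)

theorem toMap_eq_zero_iff {p : P} {w : EP} : Θ.toMap p w = 0 ↔ Θ.form p w = 0 :=
  ⟨fun h => Subtype.ext h, fun h => congrArg Subtype.val h⟩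

theorem deriv_toMap_invDeriv (hσ : σ ∈ τ.baseSet) (g : G) (v : EB) (V : EG) :
    τ.deriv (τ.inv σ g) (Θ.toMap (τ.inv σ g) (τ.invDeriv σ g (v, V))) =
      (0, V + Θ.localForm τ σ g v) := by
  have h3 : ((v, V) : EB × EG) = (0, V) + (v, 0) := by simp
  have h4 : Θ.toMap (τ.inv σ g) (τ.invDeriv σ g (0, V)) = τ.invDeriv σ g (0, V) :=
    Θ.toMap_of_vertical (mfderiv_proj_invDeriv hσ g _)
  refine Prod.ext ?_ ?_
  · exact (fst_deriv (inv_mem_source hσ g) _).trans (Θ.mfderiv_proj_toMap _ _)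
  · rw [h3, map_add, map_add, map_add, h4, deriv_invDeriv hσ, localForm_apply]
    rfl

/-- The moment map reads `s` in the trivialisation and does not see the vector `(v, 0)`, so the
condition `T μ ∘ Θ = T μ` forces `T s` to vanish on the horizontal part. -/
theorem sourceDeriv_localForm (hσ : σ ∈ τ.baseSet) (g : G) (v : EB) :
    𝒢.sourceDeriv g (Θ.localForm τ σ g v) = 0 := by
  have h1 := sourceDeriv_snd_deriv (inv_mem_source hσ g)
    (Θ.toMap (τ.inv σ g) (τ.invDeriv σ g (v, 0)))
  rw [apply_inv hσ] at h1
  refine h1.trans ((Θ.moment (τ.inv σ g) (τ.invDeriv σ g (v, 0))).trans ?_)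
  exact (mfderiv_μ_invDeriv hσ g (v, 0)).trans (map_zero _)

/-- The horizontal lift of `v`: in a trivialisation, the graph of the negative of the horizontal
part consists of horizontal vectors. -/
theorem toMap_eq_zero_of_localForm (hσ : σ ∈ τ.baseSet) (g : G) (v : EB) :
    Θ.toMap (τ.inv σ g) (τ.invDeriv σ g (v, -Θ.localForm τ σ g v)) = 0 := by
  rw [← invDeriv_deriv hσ g (Θ.toMap _ _), Θ.deriv_toMap_invDeriv hσ, neg_add_cancel]
  exact map_zero _

/-- The action sends the horizontal lift `(v, -a(g) v)` at `g` to `(v, -T r_h (a(g) v))` at `g.h`.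
By invariance this is again horizontal, hence is the lift of `v` there. Only the inclusion of the
image of the kernel in the kernel is needed. -/
theorem rightDeriv_localForm [IsManifold 𝓘(ℝ, EG) 1 G] (hσ : σ ∈ τ.baseSet) {g h : G}
    (hgh : 𝒢.s g = 𝒢.t h) (v : EB) :
    𝒢.rightDeriv h g (Θ.localForm τ σ g v) = Θ.localForm τ σ (𝒢.mul g h) v := by
  have h1 := Θ.toMap_eq_zero_of_localForm hσ g v
  have h2 : X.μ (τ.inv σ g) = 𝒢.t h := (τ.μ_symm σ hσ g).trans hgh
  have h3 := mfderivWithin_act (X := X) hσ hgh (v := v) (V := -Θ.localForm τ σ g v)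
    (by rw [map_neg, Θ.sourceDeriv_localForm hσ, neg_zero])
  have h4 := (Θ.invariant (τ.inv σ g) h h2).le (Submodule.mem_map_of_mem
    (Θ.toMap_eq_zero_iff.1 h1))
  have h5 : Θ.toMap (X.act (τ.inv σ g) h)
      (τ.invDeriv σ (𝒢.mul g h) (v, 𝒢.rightDeriv h g (-Θ.localForm τ σ g v))) = 0 := by
    rw [← h3]
    exact Θ.toMap_eq_zero_iff.2 h4
  have h6 : X.act (τ.inv σ g) h = τ.inv σ (𝒢.mul g h) := τ.act_symm σ hσ g h hgh
  rw [h6] at h5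
  have h7 := Θ.deriv_toMap_invDeriv hσ (𝒢.mul g h) v (𝒢.rightDeriv h g (-Θ.localForm τ σ g v))
  rw [h5, map_zero, map_neg] at h7
  have h8 := congrArg Prod.snd h7
  exact (neg_add_eq_zero.1 h8.symm)

/-- One vector, `T τ'⁻¹ (v, 0)`, is fed to the form and the result is read in both trivialisations.
The first term appears because this vector acquires a component along `G` when seen through `τ`. -/
theorem localForm_transition (hσ : σ ∈ τ.baseSet) (hσ' : σ ∈ τ'.baseSet) (g : G) (v : EB) :
    𝒢.rightDeriv g (transitionArrow τ τ' σ (𝒢.t g)) (transitionDeriv τ τ' σ (𝒢.t g) v) +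
        Θ.localForm τ σ ((transition τ τ' σ hσ hσ').left g) v =
      (transition τ τ' σ hσ hσ').leftDeriv g (Θ.localForm τ' σ g v) := by
  set β := transition τ τ' σ hσ hσ' with hβ
  have hp : τ.inv σ (β.left g) = τ'.inv σ g := inv_transition hσ hσ' g
  have h1 := deriv_invDeriv_transition hσ hσ' g v 0
  rw [map_zero, add_zero] at h1
  have h2 := invDeriv_deriv hσ (β.left g) (τ'.invDeriv σ g (v, 0))
  rw [hp, h1] at h2
  have h3 := Θ.deriv_toMap_invDeriv hσ (β.left g) v
    (𝒢.rightDeriv g (transitionArrow τ τ' σ (𝒢.t g)) (transitionDeriv τ τ' σ (𝒢.t g) v))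
  rw [h2, hp] at h3
  have h4 := Θ.deriv_toMap_invDeriv hσ' g v 0
  rw [zero_add] at h4
  have h5 := invDeriv_deriv hσ' g (Θ.toMap (τ'.inv σ g) (τ'.invDeriv σ g (v, 0)))
  rw [h4] at h5
  have h6 := deriv_invDeriv_transition hσ hσ' g 0 (Θ.localForm τ' σ g v)
  rw [h5, h3, map_zero, map_zero, zero_add] at h6
  exact congrArg Prod.snd h6

variable [IsManifold 𝓘(ℝ, EB) ∞ B] [IsManifold 𝓘(ℝ, EG) ∞ G]

theorem contMDiffOn_localForm :
    ContMDiffOn (𝓘(ℝ, EB).tangent.prod 𝓘(ℝ, EM)) 𝓘(ℝ, EG).tangent ∞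
      (fun q : TangentBundle 𝓘(ℝ, EB) B × M =>
        (⟨𝒢.one q.2, Θ.localForm τ q.1.proj (𝒢.one q.2) q.1.snd⟩ : TangentBundle 𝓘(ℝ, EG) G))
      {q | q.1.proj ∈ τ.baseSet} := by
  have h1 : ContMDiffOn (𝓘(ℝ, EB).tangent.prod 𝓘(ℝ, EM)) 𝓘(ℝ, EB).tangent ∞
      (fun q : TangentBundle 𝓘(ℝ, EB) B × M => q.1) {q | q.1.proj ∈ τ.baseSet} :=
    contMDiff_fst.contMDiffOn
  have h2 : ContMDiffOn (𝓘(ℝ, EB).tangent.prod 𝓘(ℝ, EM)) 𝓘(ℝ, EG) ∞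
      (fun q : TangentBundle 𝓘(ℝ, EB) B × M => 𝒢.one q.2) {q | q.1.proj ∈ τ.baseSet} :=
    (𝒢.smooth_one.comp contMDiff_snd).contMDiffOn
  have h3 := h1.tangentProdMk h2.tangentZero
  have h4 := (τ.open_target.contMDiffOn_tangentMap τ.smooth_symm).comp h3
    (fun q hq => mem_target hq _)
  have h5 := Θ.smooth.comp_contMDiffOn h4
  have h6 := (τ.open_source.contMDiffOn_tangentMap τ.smooth_toFun).comp h5
    (fun q hq => inv_mem_source hq _)
  have h7 := (contMDiff_snd (I := 𝓘(ℝ, EB)) (J := 𝓘(ℝ, EG)) (M := B) (N := G)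
    (n := ∞)).contMDiff_tangentMap (m := ∞) (by simp)
  refine (h7.comp_contMDiffOn h6).congr ?_
  intro q hq
  rw [Function.comp_apply, tangentMap_prodSnd]
  exact TangentBundle.mk_eq_mk (congrArg Prod.snd (apply_inv hq (𝒢.one q.2))).symm rfl

variable {ι : Type*} {τs : ι → X.LocalTrivialisation}

/-- Since the form is the identity on vertical vectors, the dependence on `V` is automatic and only
the horizontal parts have to be compared. -/
theorem isPresentedBy_iff {A : X.LocalConnectionData τs} :
    Θ.IsPresentedBy A ↔ ∀ (i : ι) (σ : B), σ ∈ (τs i).baseSet → ∀ (g : G) (v : EB),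
      Θ.localForm (τs i) σ g v = A.localForm i σ g v := by
  constructor
  · intro h i σ hσ g v
    have h1 := congrArg Prod.snd (h i σ hσ g v 0)
    exact (h1.trans (zero_add _)).trans
      (congrArg (𝒢.rightDeriv g (𝒢.one (𝒢.t g))) (A.coe_form hσ (𝒢.t g) v))
  · intro h i σ hσ g v V
    have h1 := congrArg (𝒢.rightDeriv g (𝒢.one (𝒢.t g))) (A.coe_form hσ (𝒢.t g) v)
    refine (Θ.deriv_toMap_invDeriv hσ g v V).trans (Prod.ext rfl ?_)
    exact congrArg (V + ·) ((h i σ hσ g v).trans h1.symm)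

variable (τs) in
/-- The local connection data of a connection form: its horizontal parts along the units. -/
def toLocalConnectionData : X.LocalConnectionData τs where
  form i σ hσ m := (Θ.localForm (τs i) σ (𝒢.one m)).codRestrict (𝒢.algebroidFibre m)
    (fun v => Θ.sourceDeriv_localForm hσ _ v)
  smooth i := by
    refine (Θ.contMDiffOn_localForm (τ := τs i)).congr ?_
    intro q hq
    refine TangentBundle.mk_eq_mk rfl ?_
    exact dif_pos hq
  gluing i j σ hi hj m v := by
    set β := transition (τs i) (τs j) σ hi hj with hβ
    -- The inverse-free gluing law is `localForm_transition` at `g = Id_m`: right translation by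
    -- `Id_m` drops out, and invariance rewrites the horizontal part at `β(m)` as a translate of the
    -- one at the unit `Id_{β ▷ m}`.
    refine (β.gluing_iff m (Θ.sourceDeriv_localForm hi _ v) (Θ.sourceDeriv_localForm hj _ v)
      (sourceDeriv_transitionDeriv hi hj m v)).2 ?_
    have h1 := Θ.localForm_transition hi hj (𝒢.one m) v
    have h2 : 𝒢.sourceDeriv (β.toFun m) (transitionDeriv (τs i) (τs j) σ m v) = 0 :=
      sourceDeriv_transitionDeriv hi hj m v
    have h3 := Θ.rightDeriv_localForm hi (𝒢.s_one (β.shadow m)) v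
    have h4 : 𝒢.mul (𝒢.one (β.shadow m)) (β.toFun m) = β.toFun m := 𝒢.one_mul _
    rw [← hβ, 𝒢.t_one, β.left_one] at h1
    erw [LieGroupoid.rightDeriv_one (β.s_toFun m) h2] at h1
    erw [h4] at h3
    erw [h3]
    exact h1

theorem isPresentedBy_toLocalConnectionData :
    Θ.IsPresentedBy (Θ.toLocalConnectionData τs) := by
  rw [isPresentedBy_iff]
  intro i σ hσ g v
  have h := Θ.rightDeriv_localForm hσ (𝒢.s_one (𝒢.t g)) v
  rw [𝒢.one_mul] at h
  refine h.symm.trans (congrArg (𝒢.rightDeriv g (𝒢.one (𝒢.t g))) ?_)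
  exact (Θ.toLocalConnectionData τs).coe_form hσ (𝒢.t g) v

/-- At `g = Id_m` the right translation in the presentation is the identity on the algebroid fibre,
so the data can be read off along the units. -/
theorem IsPresentedBy.eq_toLocalConnectionData {Θ : X.ConnectionForm}
    {A : X.LocalConnectionData τs} (h : Θ.IsPresentedBy A) : A = Θ.toLocalConnectionData τs := by
  rw [isPresentedBy_iff] at h
  ext i σ hσ m v
  have h1 : Θ.localForm (τs i) σ (𝒢.one m) v =
      𝒢.rightDeriv (𝒢.one m) (𝒢.one (𝒢.t (𝒢.one m))) (A.toMap i σ (𝒢.t (𝒢.one m)) v) :=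
    h i σ hσ (𝒢.one m) v
  rw [𝒢.t_one, LieGroupoid.rightDeriv_one (𝒢.s_one m) (A.sourceDeriv_toMap hσ m v)] at h1
  exact (A.coe_form hσ m v).trans h1.symm

theorem IsPresentedBy.unique {Θ Θ' : X.ConnectionForm} {A : X.LocalConnectionData τs}
    (hτ : ∀ σ : B, ∃ i, σ ∈ (τs i).baseSet) (h : Θ.IsPresentedBy A) (h' : Θ'.IsPresentedBy A) :
    Θ = Θ' := by
  rw [isPresentedBy_iff] at h h'
  have key : ∀ p w, Θ.toMap p w = Θ'.toMap p w := by
    intro p w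
    obtain ⟨i, hi⟩ := hτ (X.proj p)
    have hp : p ∈ (τs i).source := by rw [(τs i).source_eq]; exact hi
    obtain ⟨g, hg⟩ : ∃ g, (τs i).inv (X.proj p) g = p := ⟨_, inv_apply hp⟩
    -- Forgetting that `σ` is the projection of `p` leaves `p` as the free side of `hg`, so that it
    -- can be replaced by `τ⁻¹(σ, g)`.
    generalize X.proj p = σ at hi hg
    subst hg
    rw [← invDeriv_deriv hi g w, ← invDeriv_deriv hi g (Θ.toMap _ _),
      ← invDeriv_deriv hi g (Θ'.toMap _ _)]
    obtain ⟨v, V⟩ := (τs i).deriv ((τs i).inv σ g) w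
    rw [Θ.deriv_toMap_invDeriv hi, Θ'.deriv_toMap_invDeriv hi, h i σ hi, h' i σ hi]
  ext p w
  exact key p w

end ConnectionForm

end FibredModule

/-! ### From local data to connection forms -/

namespace FibredModule

variable {EM EG M G EB EP B P : Type*}
  [NormedAddCommGroup EM] [NormedSpace ℝ EM] [NormedAddCommGroup EG] [NormedSpace ℝ EG]
  [TopologicalSpace M] [ChartedSpace EM M] [TopologicalSpace G] [ChartedSpace EG G]
  [NormedAddCommGroup EB] [NormedSpace ℝ EB] [NormedAddCommGroup EP] [NormedSpace ℝ EP]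
  [TopologicalSpace B] [ChartedSpace EB B] [TopologicalSpace P] [ChartedSpace EP P]
  {𝒢 : LieGroupoid EM EG M G} {X : FibredModule 𝒢 EB EP B P}

open LocalTrivialisation

namespace LocalTrivialisation

theorem choose_mem_source {ι : Type*} {τ : ι → X.LocalTrivialisation}
    (hτ : ∀ σ : B, ∃ i, σ ∈ (τ i).baseSet) (p : P) :
    p ∈ (τ (hτ (X.proj p)).choose).source := by
  rw [(τ _).source_eq]; exact (hτ (X.proj p)).choose_spec

end LocalTrivialisation

namespace LocalConnectionData

variable [IsManifold 𝓘(ℝ, EB) ∞ B] [IsManifold 𝓘(ℝ, EG) ∞ G] {ι : Type*}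
  {τ : ι → X.LocalTrivialisation} (A : X.LocalConnectionData τ) {i j : ι} {σ : B} {p : P}

theorem sourceDeriv_localForm (hσ : σ ∈ (τ i).baseSet) (g : G) (v : EB) :
    𝒢.sourceDeriv g (A.localForm i σ g v) = 0 := by
  have h := LieGroupoid.sourceDeriv_rightDeriv (𝒢.s_one (𝒢.t g)) (A.sourceDeriv_toMap hσ (𝒢.t g) v)
  rw [𝒢.one_mul] at h
  exact h

theorem rightDeriv_localForm (hσ : σ ∈ (τ i).baseSet) {g h : G} (hgh : 𝒢.s g = 𝒢.t h) (v : EB) :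
    𝒢.rightDeriv h g (A.localForm i σ g v) = A.localForm i σ (𝒢.mul g h) v := by
  have h1 := LieGroupoid.rightDeriv_rightDeriv (𝒢.s_one (𝒢.t g)) hgh
    (A.sourceDeriv_toMap hσ (𝒢.t g) v)
  rw [𝒢.one_mul] at h1
  refine h1.trans ?_
  rw [localForm, 𝒢.t_mul _ _ hgh]
  rfl

/-- The gluing law at the object `t g`, rid of inverses and then right translated by `g`. -/
theorem localForm_transition (hi : σ ∈ (τ i).baseSet) (hj : σ ∈ (τ j).baseSet) (g : G) (v : EB) :
    𝒢.rightDeriv g (transitionArrow (τ i) (τ j) σ (𝒢.t g))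
          (transitionDeriv (τ i) (τ j) σ (𝒢.t g) v) +
        A.localForm i σ ((transition (τ i) (τ j) σ hi hj).left g) v =
      (transition (τ i) (τ j) σ hi hj).leftDeriv g (A.localForm j σ g v) := by
  set β := transition (τ i) (τ j) σ hi hj with hβ
  have h1 : A.toMap i σ (β.shadow (𝒢.t g)) v = β.conjDeriv (𝒢.t g) (A.toMap j σ (𝒢.t g) v) -
      𝒢.rightDeriv (𝒢.inv (β.toFun (𝒢.t g))) (β.toFun (𝒢.t g))
        (transitionDeriv (τ i) (τ j) σ (𝒢.t g) v) := by
    rw [← A.coe_form hi, ← A.coe_form hj]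
    exact A.gluing i j σ hi hj (𝒢.t g) v
  have h2 := (β.gluing_iff (𝒢.t g) (A.sourceDeriv_toMap hi _ v) (A.sourceDeriv_toMap hj _ v)
    (sourceDeriv_transitionDeriv hi hj (𝒢.t g) v)).1 h1
  have h3 := β.gluing_right g (A.sourceDeriv_toMap hi _ v) (A.sourceDeriv_toMap hj _ v) h2
  rw [localForm, β.t_left]
  exact h3

/-- The endomorphism of the tangent space at `p` that local connection data determine in the `i`-th
local trivialisation. -/
def lift (i : ι) (p : P) : EP →L[ℝ] EP :=
  ((τ i).invDeriv (X.proj p) ((τ i).toOpenPartialHomeomorph p).2).comp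
    (((ContinuousLinearMap.inr ℝ EB EG).comp (ContinuousLinearMap.snd ℝ EB EG +
      (A.localForm i (X.proj p) ((τ i).toOpenPartialHomeomorph p).2).comp
        (ContinuousLinearMap.fst ℝ EB EG))).comp ((τ i).deriv p))

theorem lift_apply (i : ι) (p : P) (w : EP) : A.lift i p w =
    (τ i).invDeriv (X.proj p) ((τ i).toOpenPartialHomeomorph p).2
      (0, ((τ i).deriv p w).2 +
        A.localForm i (X.proj p) ((τ i).toOpenPartialHomeomorph p).2 ((τ i).deriv p w).1) := rfl

theorem lift_invDeriv (hσ : σ ∈ (τ i).baseSet) (g : G) (w : EB × EG) :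
    A.lift i ((τ i).inv σ g) ((τ i).invDeriv σ g w) =
      (τ i).invDeriv σ g (0, w.2 + A.localForm i σ g w.1) := by
  rw [lift_apply, deriv_invDeriv hσ, apply_inv hσ, proj_inv hσ]

/-- Changing trivialisation adds the derivative of the transition bisection to the component along
`G`. By `localForm_transition` this is exactly the amount by which the two horizontal parts differ.
-/
theorem lift_eq_lift (hi : p ∈ (τ i).source) (hj : p ∈ (τ j).source) : A.lift i p = A.lift j p := by
  ext w
  have hσi := proj_mem_baseSet hi
  have hσj := proj_mem_baseSet hj
  obtain ⟨g, hg⟩ : ∃ g, (τ j).inv (X.proj p) g = p := ⟨_, inv_apply hj⟩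
  generalize X.proj p = σ at hσi hσj hg
  subst hg
  set β := transition (τ i) (τ j) σ hσi hσj with hβ
  have hp : (τ i).inv σ (β.left g) = (τ j).inv σ g := inv_transition hσi hσj g
  rw [← invDeriv_deriv hσj g w]
  obtain ⟨v, V⟩ := (τ j).deriv ((τ j).inv σ g) w
  have h1 := deriv_invDeriv_transition hσi hσj g v V
  have h2 := deriv_invDeriv_transition hσi hσj g 0 (V + A.localForm j σ g v)
  have h3 := invDeriv_deriv hσi (β.left g) ((τ j).invDeriv σ g (v, V))
  have h4 := invDeriv_deriv hσi (β.left g) ((τ j).invDeriv σ g (0, V + A.localForm j σ g v))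
  rw [hp, h1] at h3
  rw [hp, h2, map_zero, map_zero, zero_add, map_add, ← A.localForm_transition hσi hσj] at h4
  have h5 := A.lift_invDeriv hσi (β.left g) (v, 𝒢.rightDeriv g (transitionArrow (τ i) (τ j) σ
    (𝒢.t g)) (transitionDeriv (τ i) (τ j) σ (𝒢.t g) v) + β.leftDeriv g V)
  rw [h3, hp] at h5
  rw [h5, A.lift_invDeriv hσj, ← h4]
  congr 2
  exact (add_assoc _ _ _).trans (add_left_comm _ _ _)

theorem mfderiv_proj_lift (hp : p ∈ (τ i).source) (w : EP) :
    mfderiv 𝓘(ℝ, EP) 𝓘(ℝ, EB) X.proj p (A.lift i p w) = 0 := by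
  have h := mfderiv_proj_invDeriv (proj_mem_baseSet hp) ((τ i).toOpenPartialHomeomorph p).2
    (0, ((τ i).deriv p w).2 +
        A.localForm i (X.proj p) ((τ i).toOpenPartialHomeomorph p).2 ((τ i).deriv p w).1)
  rw [inv_apply hp] at h
  exact h

theorem lift_of_vertical (hp : p ∈ (τ i).source) {w : EP}
    (hw : mfderiv 𝓘(ℝ, EP) 𝓘(ℝ, EB) X.proj p w = 0) : A.lift i p w = w := by
  have h1 := invDeriv_deriv (proj_mem_baseSet hp) ((τ i).toOpenPartialHomeomorph p).2 w
  rw [inv_apply hp] at h1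
  have h2 : ((τ i).deriv p w).1 = 0 := (fst_deriv hp w).trans hw
  rw [lift_apply, h2, map_zero, add_zero]
  refine (congrArg ((τ i).invDeriv _ _) ?_).trans h1
  exact Prod.ext h2.symm rfl

theorem mfderiv_μ_lift (hp : p ∈ (τ i).source) (w : EP) :
    mfderiv 𝓘(ℝ, EP) 𝓘(ℝ, EM) X.μ p (A.lift i p w) =
      mfderiv 𝓘(ℝ, EP) 𝓘(ℝ, EM) X.μ p w := by
  have hσ := proj_mem_baseSet hp
  obtain ⟨g, hg⟩ : ∃ g, (τ i).inv (X.proj p) g = p := ⟨_, inv_apply hp⟩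
  generalize X.proj p = σ at hσ hg
  subst hg
  rw [← invDeriv_deriv hσ g w, A.lift_invDeriv hσ]
  refine (mfderiv_μ_invDeriv hσ g _).trans (Eq.trans ?_ (mfderiv_μ_invDeriv hσ g _).symm)
  rw [map_add, A.sourceDeriv_localForm hσ, add_zero]

/-- Parametrises the kernel by base vectors `v`, through horizontal lifts. This is what yields both
inclusions of the invariance condition in `map_ker_lift`. -/
theorem lift_eq_zero_iff (hσ : σ ∈ (τ i).baseSet) (g : G) (w : EP) :
    A.lift i ((τ i).inv σ g) w = 0 ↔ ∃ v, (τ i).invDeriv σ g (v, -A.localForm i σ g v) = w := by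
  constructor
  · intro h
    obtain ⟨u, rfl⟩ : ∃ u, (τ i).invDeriv σ g u = w := ⟨_, invDeriv_deriv hσ g w⟩
    refine ⟨u.1, congrArg _ (Prod.ext rfl ?_)⟩
    rw [A.lift_invDeriv hσ] at h
    have h1 := deriv_invDeriv hσ g (0, u.2 + A.localForm i σ g u.1)
    rw [h, map_zero] at h1
    exact (eq_neg_iff_add_eq_zero.2 (congrArg Prod.snd h1).symm).symm
  · rintro ⟨v, rfl⟩
    rw [A.lift_invDeriv hσ, neg_add_cancel]
    exact map_zero _

theorem map_ker_lift (hp : p ∈ (τ i).source) {h : G} (hph : X.μ p = 𝒢.t h) (w : EP) :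
    A.lift i (X.act p h) w = 0 ↔ ∃ w', A.lift i p w' = 0 ∧
      mfderivWithin 𝓘(ℝ, EP) 𝓘(ℝ, EP) (fun q => X.act q h) {q | X.μ q = 𝒢.t h} p w' = w := by
  have hσ := proj_mem_baseSet hp
  obtain ⟨g, hg⟩ : ∃ g, (τ i).inv (X.proj p) g = p := ⟨_, inv_apply hp⟩
  generalize X.proj p = σ at hσ hg
  subst hg
  have hgh : 𝒢.s g = 𝒢.t h := ((τ i).μ_symm σ hσ g).symm.trans hph
  have hact : X.act ((τ i).inv σ g) h = (τ i).inv σ (𝒢.mul g h) := (τ i).act_symm σ hσ g h hgh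
  -- The action carries the horizontal lift of `v` at `g` to the horizontal lift of the same `v` at
  -- `g.h`, so it matches the two parametrisations of the kernels.
  have key : ∀ v : EB, mfderivWithin 𝓘(ℝ, EP) 𝓘(ℝ, EP) (fun q => X.act q h) {q | X.μ q = 𝒢.t h}
      ((τ i).inv σ g) ((τ i).invDeriv σ g (v, -A.localForm i σ g v)) =
        (τ i).invDeriv σ (𝒢.mul g h) (v, -A.localForm i σ (𝒢.mul g h) v) := by
    intro v
    have h1 := mfderivWithin_act (X := X) hσ hgh (v := v) (V := -A.localForm i σ g v)
      (by rw [map_neg, A.sourceDeriv_localForm hσ, neg_zero])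
    rw [map_neg, A.rightDeriv_localForm hσ hgh] at h1
    exact h1
  rw [hact]
  refine (A.lift_eq_zero_iff hσ (𝒢.mul g h) w).trans ?_
  constructor
  · rintro ⟨v, hv⟩
    exact ⟨_, (A.lift_eq_zero_iff hσ g _).2 ⟨v, rfl⟩, (key v).trans hv⟩
  · rintro ⟨w', hw', hw⟩
    obtain ⟨v, rfl⟩ := (A.lift_eq_zero_iff hσ g w').1 hw'
    exact ⟨v, (key v).symm.trans hw⟩

theorem contMDiffOn_toMap (i : ι) :
    ContMDiffOn (𝓘(ℝ, EB).tangent.prod 𝓘(ℝ, EM)) 𝓘(ℝ, EG).tangent ∞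
      (fun q : TangentBundle 𝓘(ℝ, EB) B × M =>
        (⟨𝒢.one q.2, A.toMap i q.1.proj q.2 q.1.snd⟩ : TangentBundle 𝓘(ℝ, EG) G))
      {q | q.1.proj ∈ (τ i).baseSet} := by
  refine (A.smooth i).congr ?_
  intro q hq
  refine TangentBundle.mk_eq_mk rfl ?_
  refine (A.coe_form hq q.2 q.1.snd).symm.trans ?_
  symm
  exact dif_pos hq

/-- The lift is a composite of smooth maps: `T τ`, evaluation of the data at `(σ, t g)`, right
translation by `g`, fibrewise addition, and `T τ⁻¹`. The third is where `contMDiffOn_rightDeriv`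
enters. -/
theorem contMDiffOn_lift [IsManifold 𝓘(ℝ, EP) ∞ P] (i : ι) :
    ContMDiffOn 𝓘(ℝ, EP).tangent 𝓘(ℝ, EP).tangent ∞
      (fun w : TangentBundle 𝓘(ℝ, EP) P =>
        (⟨w.proj, A.lift i w.proj w.snd⟩ : TangentBundle 𝓘(ℝ, EP) P))
      {w | w.proj ∈ (τ i).source} := by
  have h1 := (τ i).open_source.contMDiffOn_tangentMap (τ i).smooth_toFun
  have h2 := ((contMDiff_fst (I := 𝓘(ℝ, EB)) (J := 𝓘(ℝ, EG)) (M := B) (N := G)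
    (n := ∞)).contMDiff_tangentMap (m := ∞) (by simp)).comp_contMDiffOn h1
  have h3 := ((contMDiff_snd (I := 𝓘(ℝ, EB)) (J := 𝓘(ℝ, EG)) (M := B) (N := G)
    (n := ∞)).contMDiff_tangentMap (m := ∞) (by simp)).comp_contMDiffOn h1
  have h2' : ContMDiffOn 𝓘(ℝ, EP).tangent 𝓘(ℝ, EB).tangent ∞
      (fun w : TangentBundle 𝓘(ℝ, EP) P =>
        (⟨X.proj w.proj, ((τ i).deriv w.proj w.snd).1⟩ : TangentBundle 𝓘(ℝ, EB) B))
      {w | w.proj ∈ (τ i).source} := by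
    refine h2.congr fun w hw => ?_
    rw [Function.comp_apply, tangentMap_prodFst]
    exact TangentBundle.mk_eq_mk (fst_apply hw).symm rfl
  have h3' : ContMDiffOn 𝓘(ℝ, EP).tangent 𝓘(ℝ, EG).tangent ∞
      (fun w : TangentBundle 𝓘(ℝ, EP) P =>
        (⟨((τ i).toOpenPartialHomeomorph w.proj).2, ((τ i).deriv w.proj w.snd).2⟩ :
          TangentBundle 𝓘(ℝ, EG) G)) {w | w.proj ∈ (τ i).source} := by
    refine h3.congr fun w hw => ?_
    rw [Function.comp_apply, tangentMap_prodSnd]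
    rfl
  have h4 : ContMDiffOn 𝓘(ℝ, EP).tangent 𝓘(ℝ, EG) ∞
      (fun w : TangentBundle 𝓘(ℝ, EP) P => ((τ i).toOpenPartialHomeomorph w.proj).2)
      {w | w.proj ∈ (τ i).source} :=
    (contMDiff_snd.comp_contMDiffOn (τ i).smooth_toFun).comp
      (contMDiff_proj (TangentSpace 𝓘(ℝ, EP))).contMDiffOn (fun w hw => hw)
  have h5 := (A.contMDiffOn_toMap i).comp (h2'.prodMk (𝒢.smooth_t.comp_contMDiffOn h4))
    (fun w hw => proj_mem_baseSet hw)
  have h6 := LieGroupoid.contMDiffOn_rightDeriv h4 h5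
    (fun w hw => A.sourceDeriv_toMap (proj_mem_baseSet hw) _ _)
  have h7 := h3'.tangentAdd h6
  have h8 : ContMDiffOn 𝓘(ℝ, EP).tangent 𝓘(ℝ, EB) ∞
      (fun w : TangentBundle 𝓘(ℝ, EP) P => X.proj w.proj) {w | w.proj ∈ (τ i).source} :=
    (X.smooth_proj.comp (contMDiff_proj (TangentSpace 𝓘(ℝ, EP)))).contMDiffOn
  have h9 := ((τ i).open_target.contMDiffOn_tangentMap (τ i).smooth_symm).comp
    (h8.tangentZero.tangentProdMk h7) (fun w hw => mem_target (proj_mem_baseSet hw) _)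
  refine h9.congr fun w hw => ?_
  exact TangentBundle.mk_eq_mk (inv_apply hw).symm rfl

/-- The vertical-valued 1-form determined by local connection data. -/
def verticalForm (hτ : ∀ σ : B, ∃ i, σ ∈ (τ i).baseSet) (p : P) :
    TangentSpace 𝓘(ℝ, EP) p →L[ℝ] X.vertical p :=
  ContinuousLinearMap.codRestrict (A.lift (hτ (X.proj p)).choose p :
    TangentSpace 𝓘(ℝ, EP) p →L[ℝ] TangentSpace 𝓘(ℝ, EP) p) (X.vertical p)
    (fun w => A.mfderiv_proj_lift (choose_mem_source hτ p) w)

theorem coe_verticalForm (hτ : ∀ σ : B, ∃ i, σ ∈ (τ i).baseSet) (hp : p ∈ (τ i).source) (w : EP) :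
    (A.verticalForm hτ p w).1 = A.lift i p w :=
  DFunLike.congr_fun (A.lift_eq_lift (choose_mem_source hτ p) hp) w

theorem verticalForm_eq_zero_iff (hτ : ∀ σ : B, ∃ i, σ ∈ (τ i).baseSet) (hp : p ∈ (τ i).source)
    (w : TangentSpace 𝓘(ℝ, EP) p) : A.verticalForm hτ p w = 0 ↔ A.lift i p w = 0 :=
  ⟨fun h => (A.coe_verticalForm hτ hp w).symm.trans (congrArg Subtype.val h),
    fun h => Subtype.ext ((A.coe_verticalForm hτ hp w).trans h)⟩

variable [IsManifold 𝓘(ℝ, EP) ∞ P]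

/-- The connection form determined by local connection data. -/
def toConnectionForm (hτ : ∀ σ : B, ∃ i, σ ∈ (τ i).baseSet) : X.ConnectionForm where
  form := A.verticalForm hτ
  smooth := by
    intro w₀
    have hs := choose_mem_source hτ w₀.proj
    -- The index chosen in `verticalForm` may jump from point to point. Near `w₀` it can be frozen
    -- at this `i`, since the lift does not depend on the trivialisation.
    set i := (hτ (X.proj w₀.proj)).choose
    have hn := ((τ i).open_source.preimage (FiberBundle.continuous_proj _ _)).mem_nhds hs
    refine ((A.contMDiffOn_lift i).contMDiffAt hn).congr_of_eventuallyEq ?_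
    filter_upwards [hn] with w hw
    exact TangentBundle.mk_eq_mk rfl (A.coe_verticalForm hτ hw w.snd)
  form_vertical p w := Subtype.ext ((A.coe_verticalForm hτ (choose_mem_source hτ p) w.1).trans
    (A.lift_of_vertical (choose_mem_source hτ p) w.2))
  moment p w := A.mfderiv_μ_lift (choose_mem_source hτ p) w
  invariant p g hpg := by
    have hs := choose_mem_source hτ p
    set i := (hτ (X.proj p)).choose
    have hi : X.act p g ∈ (τ i).source := by
      rw [(τ i).source_eq, mem_preimage, X.proj_act p g hpg]
      exact proj_mem_baseSet hs
    ext w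
    rw [Submodule.mem_map]
    refine Iff.trans ?_ ((A.map_ker_lift hs hpg w).symm.trans
      (A.verticalForm_eq_zero_iff hτ hi w).symm)
    exact exists_congr fun u => and_congr_left fun _ => A.verticalForm_eq_zero_iff hτ hs u

theorem toMap_toConnectionForm (hτ : ∀ σ : B, ∃ i, σ ∈ (τ i).baseSet) (hp : p ∈ (τ i).source)
    (w : EP) : (A.toConnectionForm hτ).toMap p w = A.lift i p w :=
  A.coe_verticalForm hτ hp w

theorem isPresentedBy_toConnectionForm (hτ : ∀ σ : B, ∃ i, σ ∈ (τ i).baseSet) :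
    (A.toConnectionForm hτ).IsPresentedBy A := by
  rw [ConnectionForm.isPresentedBy_iff]
  intro i σ hσ g v
  rw [ConnectionForm.localForm_apply, A.toMap_toConnectionForm hτ (inv_mem_source hσ g),
    A.lift_invDeriv hσ, deriv_invDeriv hσ, zero_add]

end LocalConnectionData

end FibredModule

end

/-! ### The bijection -/

theorem mainTheorem4 {EM EG EB EP M G B P : Type*}
    [NormedAddCommGroup EM] [NormedSpace ℝ EM] [FiniteDimensional ℝ EM]
    [NormedAddCommGroup EG] [NormedSpace ℝ EG] [FiniteDimensional ℝ EG]
    [NormedAddCommGroup EB] [NormedSpace ℝ EB] [FiniteDimensional ℝ EB]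
    [NormedAddCommGroup EP] [NormedSpace ℝ EP] [FiniteDimensional ℝ EP]
    [TopologicalSpace M] [ChartedSpace EM M] [IsManifold 𝓘(ℝ, EM) ∞ M]
    [TopologicalSpace G] [ChartedSpace EG G] [IsManifold 𝓘(ℝ, EG) ∞ G]
    [TopologicalSpace B] [ChartedSpace EB B] [IsManifold 𝓘(ℝ, EB) ∞ B]
    [TopologicalSpace P] [ChartedSpace EP P] [IsManifold 𝓘(ℝ, EP) ∞ P]
    (𝒢 : LieGroupoid EM EG M G) (X : PrincipaloidBundle 𝒢 EB EP B P)
    {ι : Type*} (τ : ι → X.LocalTrivialisation) (hτ : ∀ σ : B, ∃ i, σ ∈ (τ i).baseSet) :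
    ∃ Φ : X.ConnectionForm ≃ X.LocalConnectionData τ,
      ∀ (Θ : X.ConnectionForm) (A : X.LocalConnectionData τ), Φ Θ = A ↔ Θ.IsPresentedBy A :=
  ⟨{ toFun := fun Θ => Θ.toLocalConnectionData τ
     invFun := fun A => A.toConnectionForm hτ
     -- The original form and the reconstructed one are presented by the same data, and over a cover
     -- the data determine the form.
     left_inv := fun Θ => FibredModule.ConnectionForm.IsPresentedBy.unique hτ
      (FibredModule.LocalConnectionData.isPresentedBy_toConnectionForm _ hτ)
      Θ.isPresentedBy_toLocalConnectionData
     right_inv := fun A => (A.isPresentedBy_toConnectionForm hτ).eq_toLocalConnectionData.symm },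
    fun Θ _ => ⟨fun h => h ▸ Θ.isPresentedBy_toLocalConnectionData,
      fun h => h.eq_toLocalConnectionData.symm⟩⟩
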